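/- For a finite simple graph $G$ and $A\subseteq V(G)$ let $N(A)$ be the set of vertices outside $A$ that have at least one neighbor in $A$. For real numbers $s,g,l$, call $G$ an $(s,g,l)$-expander if (i) $|N(A)|\ge s|A|$ for every $A\subseteq V(G)$ with $|A|\le g$, and (ii) there is an edge of $G$ between any two disjoint sets $A,B\subseteq V(G)$ with $|A|,|B|\ge l$. A graph on $n$ vertices is called an $s$-expander if it is an $\left(s,\ \frac{4n\ln s}{s\ln n},\ \frac{n\ln s}{3000\ln n}\right)$-expander. Corollary. For every constant $\alpha$ with $0<\alpha\le 1$ there is an $n_0$ such that for every $n\ge n_0$ the following holds: for every $n^{\alpha}$-expander $G$ on $n$ vertices and every matching $M$ of $G$, there exist at most $14000/\alpha^4$ Hamilton cycles of $G$ such that every edge of $M$ lies in at least one of them. -/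

import Mathlib

namespace HamCover

variable {V : Type*} [Fintype V]

/-- The neighborhood `N(A)`: the vertices outside `A` with at least one neighbor in `A`. -/
noncomputable def nbhd (G : SimpleGraph V) (A : Finset V) : Finset V :=
  open Classical in Finset.univ.filter fun v => v ∉ A ∧ ∃ a ∈ A, G.Adj a v

/-- The small expander property `S(s, g)`, with expansion factor `s` and boundary `g`. -/
def SmallExpander (G : SimpleGraph V) (s g : ℝ) : Prop :=
  ∀ A : Finset V, (A.card : ℝ) ≤ g → (A.card : ℝ) * s ≤ ((nbhd G A).card : ℝ)

/-- The large expander property `L(l)` with frame `l`. -/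
def LargeExpander (G : SimpleGraph V) (l : ℝ) : Prop :=
  ∀ A B : Finset V, Disjoint A B → l ≤ (A.card : ℝ) → l ≤ (B.card : ℝ) →
    ∃ a ∈ A, ∃ b ∈ B, G.Adj a b

/-- `(s, g, l)`-expanders. -/
def IsExpander (G : SimpleGraph V) (s g l : ℝ) : Prop :=
  SmallExpander G s g ∧ LargeExpander G l

/-- `s`-expanders: with `n` the number of vertices, the `(s, g, l)`-expanders for
`g = 4 n ln s / (s ln n)` and `l = n ln s / (3000 ln n)`. -/
def IsSExpander (G : SimpleGraph V) (s : ℝ) : Prop :=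
  IsExpander G s
    (4 * (Fintype.card V : ℝ) * Real.log s / (s * Real.log (Fintype.card V : ℝ)))
    ((Fintype.card V : ℝ) * Real.log s / (3000 * Real.log (Fintype.card V : ℝ)))

/-- `H` is a Hamilton cycle of `G`, regarded as a subgraph: it consists of the vertices and
edges of a closed walk that is a Hamiltonian cycle. -/
def IsHamiltonCycle {G : SimpleGraph V} (H : G.Subgraph) : Prop :=
  open Classical in ∃ (v : V) (p : G.Walk v v), p.IsHamiltonianCycle ∧ H = p.toSubgraph

end HamCover

/-! Split the matching into boundedly many sparse pieces, each leaving half of every small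
neighborhood uncovered, and put each piece into one Hamilton cycle by Pósa rotations that never
break a matching edge.

Splitting. With `s = n ^ α` one has `ln s = α ln n`, so the expander has boundary `g = 4αn/s` and
frame `l = αn/3000`. Colour the matching edges randomly with 256 colours. A union bound over the
sets `A` with `|A| ≤ g` gives a colouring in which each colour meets at most half of every `N(A)`
(`exists_balanced_coloring`). Cutting each colour class into blocks of `q ≈ αn/50` labels makes each
piece cover at most `2q` vertices, and there are only `O(1/α)` pieces (`IsExpander.exists_cover`).

One piece. Take a longest path containing every edge of the piece that it meets, and rotate only at
uncovered (free) vertices. Small sets still expand by `s/2` into free vertices, so `k ≈ 1/α`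
rotations give `l` ends, and one more gives about `n/3` (`LongestPath.le_card_ends`,
`LongestPath.card_bounds`). To join the two ends (`exists_closed_longestPath`), divide the path into
`2k+4` blocks. The `2k+2` rotations used to move both ends spoil at most `2k+2` blocks, so two
survive. Cut the path between them and rotate each half separately. A half containing a long intact
block yields at least `l` ends unless its starting vertex is in the small `badSet` of that block,
which was avoided in advance. Two disjoint end sets of size `l` span an edge, which closes the path.
Connectivity and maximality then make the cycle Hamiltonian (`LongestPath.mem_of_closed`). -/

namespace HamCover

/-! ### Blocks of lists, up to reversal -/

section Lists

variable {V : Type*}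

/-- The list `I`, or its reverse, occurs as a block of consecutive entries of `L`. -/
def Survives (I L : List V) : Prop := I <:+: L ∨ I.reverse <:+: L

theorem Survives.symm_pair {x y : V} {L : List V} (h : Survives [x, y] L) :
    Survives [y, x] L := by
  simpa [Survives] using h.symm

theorem survives_reverse_right {I L : List V} : Survives I L.reverse ↔ Survives I L := by
  unfold Survives
  rw [← List.reverse_infix, List.reverse_reverse, List.reverse_infix, or_comm]

theorem survives_reverse_left {I L : List V} : Survives I.reverse L ↔ Survives I L := by
  unfold Survives
  rw [List.reverse_reverse, or_comm]

theorem Survives.trans {I J L : List V} (h : Survives I J) (h' : Survives J L) :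
    Survives I L := by
  rcases h' with h' | h'
  · exact h.imp (·.trans h') (·.trans h')
  · exact (survives_reverse_right.2 h).imp (·.trans h') (·.trans h')

theorem Survives.mono {I J L : List V} (h : Survives I J) (h' : J <:+: L) : Survives I L :=
  h.imp (·.trans h') (·.trans h')

theorem Survives.subset {I L : List V} (h : Survives I L) : I ⊆ L := by
  rcases h with h | h
  · exact h.subset
  · intro x hx
    exact h.subset (by simpa using hx)

/-- A block of `X ++ Y` which does not contain the junction `a u` is a block of one part. -/
theorem infix_append_cases {I B A : List V} {a u : V} (h : I <:+: B ++ a :: u :: A)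
    (hI : ¬ (a ∈ I ∧ u ∈ I)) : I <:+: B ++ [a] ∨ I <:+: u :: A := by
  have h' : I <:+: (B ++ [a]) ++ (u :: A) := by simpa using h
  rw [List.infix_append_iff_ne_nil] at h'
  rcases h' with h' | h' | ⟨l₁, l₂, h₁, h₂, rfl, hs, hp⟩
  · exact Or.inl h'
  · exact Or.inr h'
  · exfalso
    apply hI
    constructor
    · obtain ⟨t, ht⟩ := hs
      have := congrArg List.getLast? ht
      rw [List.getLast?_append_of_ne_nil _ h₁] at this
      simp at this
      exact List.mem_append_left _ (List.mem_of_getLast? this)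
    · obtain ⟨t, ht⟩ := hp
      cases l₂ with
      | nil => exact absurd rfl h₂
      | cons c l =>
        simp at ht
        simp [ht.1]

/-- Reversing an initial part of a list keeps every block avoiding the junction. -/
theorem Survives.rotate {I B A : List V} {a u : V} (h : Survives I (B ++ a :: u :: A))
    (hI : ¬ (a ∈ I ∧ u ∈ I)) : Survives I (a :: (B.reverse ++ u :: A)) := by
  have key : ∀ I : List V, ¬ (a ∈ I ∧ u ∈ I) → I <:+: B ++ a :: u :: A →
      Survives I (a :: (B.reverse ++ u :: A)) := by
    intro I hI h
    rcases infix_append_cases h hI with h | h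
    · right
      rw [← List.reverse_infix] at h
      refine h.trans ?_
      simp only [List.reverse_append, List.reverse_cons, List.reverse_nil, List.nil_append,
        List.singleton_append]
      exact ⟨[], u :: A, by simp⟩
    · left
      exact h.trans ⟨a :: B.reverse, [], by simp⟩
  rcases h with h | h
  · exact key I hI h
  · exact survives_reverse_left.1 (key _ (by simpa using hI) h)

theorem eq_of_infix_succ {L : List V} (hL : L.Nodup) {x a b : V} (h₁ : [x, a] <:+: L)
    (h₂ : [x, b] <:+: L) : a = b := by
  obtain ⟨s, t, rfl⟩ := h₁
  obtain ⟨s', t', h⟩ := h₂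
  simp only [List.append_assoc, List.cons_append, List.nil_append] at h hL
  have hx := (List.nodup_append.1 hL).2.2
  have hx' := (List.nodup_cons.1 (List.nodup_append.1 hL).2.1).1
  have := (List.append_cons_inj_of_notMem (fun h => hx x h x (by simp) rfl) hx').1 h.symm
  simp_all

theorem eq_of_infix_pred {L : List V} (hL : L.Nodup) {x a b : V} (h₁ : [a, x] <:+: L)
    (h₂ : [b, x] <:+: L) : a = b := by
  refine eq_of_infix_succ (L := L.reverse) (x := x) (by simpa using hL) ?_ ?_
  · rw [← List.reverse_infix]; simpa using h₁
  · rw [← List.reverse_infix]; simpa using h₂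

end Lists

end HamCover
namespace HamCover

/-! ### Pósa rotations preserving a matching -/

section Rotations

variable {V : Type*} {G M : SimpleGraph V}

/-- `x` is not covered by the edges of `M`. -/
def Free (M : SimpleGraph V) (x : V) : Prop := ∀ y, ¬ M.Adj x y

/-- A path of `G`, given by its list of vertices, such that every edge of `M` which meets the path
is an edge of the path. -/
structure ValidPath (G M : SimpleGraph V) (L : List V) : Prop where
  nodup : L.Nodup
  chain : L.IsChain G.Adj
  compat : ∀ x y, M.Adj x y → x ∈ L → Survives [x, y] L

/-- `Rot G M u L L'` says that the path `L'` arises from `L` by a rotation at the free vertex `u`,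
the last vertex of the path being kept. -/
inductive Rot (G M : SimpleGraph V) : V → List V → List V → Prop
  | mk (B : List V) (a u : V) (A : List V) (v : V) (hv : (B ++ a :: u :: A).head? = some v)
      (huv : G.Adj v u) (hu : Free M u) :
      Rot G M u (B ++ a :: u :: A) (a :: (B.reverse ++ u :: A))

/-- `Reach G M L₀ t L` says that `L` arises from `L₀` by at most `t` rotations. -/
inductive Reach (G M : SimpleGraph V) (L₀ : List V) : ℕ → List V → Prop
  | refl (t : ℕ) : Reach G M L₀ t L₀
  | step {t : ℕ} {L L' : List V} {u : V} (h : Reach G M L₀ t L) (h' : Rot G M u L L') :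
      Reach G M L₀ (t + 1) L'

theorem ValidPath.reverse {L : List V} (h : ValidPath G M L) : ValidPath G M L.reverse where
  nodup := by simpa using h.nodup
  chain := by
    rw [List.isChain_reverse]
    exact h.chain.imp fun a b hab => hab.symm
  compat x y hxy hx := survives_reverse_right.2 (h.compat x y hxy (by simpa using hx))

theorem Rot.perm {u : V} {L L' : List V} (h : Rot G M u L L') : L'.Perm L := by
  cases h with
  | mk B a u A v hv huv hu =>
    refine List.Perm.trans ?_ List.perm_middle.symm
    exact List.Perm.cons _ (List.Perm.append_right _ B.reverse_perm)

theorem Rot.append {u : V} {L L' : List V} (h : Rot G M u L L') (P : List V) :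
    Rot G M u (L ++ P) (L' ++ P) := by
  cases h with
  | mk B a u A v hv huv hu =>
    have := Rot.mk (G := G) B a u (A ++ P) v (by cases B <;> simpa using hv) huv hu
    simpa using this

theorem Rot.getLast? {u : V} {L L' : List V} (h : Rot G M u L L') :
    L'.getLast? = L.getLast? := by
  cases h with
  | mk B a u A v hv huv hu =>
    have h1 : a :: (B.reverse ++ u :: A) = (a :: B.reverse) ++ u :: A := by simp
    have h2 : B ++ a :: u :: A = (B ++ [a]) ++ u :: A := by simp
    rw [h1, h2, List.getLast?_append_of_ne_nil _ (by simp),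
      List.getLast?_append_of_ne_nil _ (by simp)]

theorem Rot.survives {u : V} {I L L' : List V} (h : Rot G M u L L') (hI : Survives I L)
    (hu : u ∉ I) : Survives I L' := by
  cases h with
  | mk B a u A v hv huv _ => exact hI.rotate fun h => hu h.2

/-- The only path edge lost joins `a` to the pivot `u`; since `u` is free, it is not an edge of `M`.
-/
theorem Rot.validPath {u : V} {L L' : List V} (h : Rot G M u L L') (hL : ValidPath G M L) :
    ValidPath G M L' where
  nodup := h.perm.nodup_iff.2 hL.nodup
  chain := by
    cases h with
    | mk B a u A v hv huv hu =>
      have h1 : a :: (B.reverse ++ u :: A) = (B ++ [a]).reverse ++ u :: A := by simp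
      have h2 : B ++ a :: u :: A = (B ++ [a]) ++ u :: A := by simp
      have hc := hL.chain
      rw [h2, List.isChain_append] at hc
      rw [h1, List.isChain_append]
      refine ⟨?_, hc.2.1, ?_⟩
      · rw [List.isChain_reverse]
        exact hc.1.imp fun a b hab => hab.symm
      · intro x hx y hy
        rw [List.getLast?_reverse] at hx
        have hx' : (B ++ a :: u :: A).head? = some x := by
          cases B <;> simpa using hx
        obtain rfl : v = x := by simpa [hv] using hx'
        obtain rfl : u = y := by simpa using hy
        exact huv
  compat x y hxy hx := by
    refine h.survives (hL.compat x y hxy (h.perm.mem_iff.1 hx)) ?_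
    have hu : Free M u := by cases h; assumption
    rintro hm
    rcases List.mem_pair.1 hm with rfl | rfl
    · exact hu _ hxy
    · exact hu _ hxy.symm

theorem Reach.mono_succ {L₀ L : List V} {t : ℕ} (h : Reach G M L₀ t L) :
    Reach G M L₀ (t + 1) L := by
  induction h with
  | refl t => exact .refl _
  | step h h' ih => exact .step ih h'

theorem Reach.perm {L₀ L : List V} {t : ℕ} (h : Reach G M L₀ t L) : L.Perm L₀ := by
  induction h with
  | refl t => exact .refl _
  | step h h' ih => exact h'.perm.trans ih

theorem Reach.getLast? {L₀ L : List V} {t : ℕ} (h : Reach G M L₀ t L) :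
    L.getLast? = L₀.getLast? := by
  induction h with
  | refl t => rfl
  | step h h' ih => exact h'.getLast?.trans ih

/-- A rotation reverses an initial part only, so one half of a cut path can be rotated while the
other half stays attached. -/
theorem Reach.validPath_append {L₀ L P : List V} {t : ℕ} (h : Reach G M L₀ t L)
    (hL : ValidPath G M (L₀ ++ P)) : ValidPath G M (L ++ P) := by
  induction h with
  | refl t => exact hL
  | step h h' ih => exact (h'.append P).validPath ih

theorem Reach.validPath {L₀ L : List V} {t : ℕ} (h : Reach G M L₀ t L)
    (hL : ValidPath G M L₀) : ValidPath G M L := by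
  simpa using h.validPath_append (P := []) (by simpa using hL)

/-- Few rotations destroy few disjoint blocks. -/
theorem Reach.exists_pivots {L₀ L : List V} {t : ℕ} (h : Reach G M L₀ t L) :
    ∃ X : Finset V, X.card ≤ t ∧
      ∀ I, Survives I L₀ → (∀ u ∈ X, u ∉ I) → Survives I L := by
  classical
  induction h with
  | refl t => exact ⟨∅, by simp, fun I hI _ => hI⟩
  | @step t L L' u h h' ih =>
    obtain ⟨X, hX, hS⟩ := ih
    refine ⟨insert u X, (Finset.card_insert_le _ _).trans (by omega), fun I hI hu => ?_⟩
    exact h'.survives (hS I hI fun w hw => hu w (Finset.mem_insert_of_mem hw))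
      (hu u (Finset.mem_insert_self _ _))

section Ends

variable [Fintype V]

open Classical in
/-- The first vertices of the paths which arise from `L₀` by at most `t` rotations. -/
noncomputable def ends (G M : SimpleGraph V) (L₀ : List V) (t : ℕ) : Finset V :=
  Finset.univ.filter fun v => ∃ L, Reach G M L₀ t L ∧ L.head? = some v

theorem mem_ends {L₀ : List V} {t : ℕ} {v : V} :
    v ∈ ends G M L₀ t ↔ ∃ L, Reach G M L₀ t L ∧ L.head? = some v := by
  simp [ends]

theorem ends_subset_succ (L₀ : List V) (t : ℕ) : ends G M L₀ t ⊆ ends G M L₀ (t + 1) := by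
  intro v hv
  obtain ⟨L, hL, hv⟩ := mem_ends.1 hv
  exact mem_ends.2 ⟨L, hL.mono_succ, hv⟩

theorem ends_mono (L₀ : List V) : Monotone (ends G M L₀) :=
  monotone_nat_of_le_succ (ends_subset_succ L₀)

theorem head_mem_ends {L₀ : List V} {v : V} (h : L₀.head? = some v) (t : ℕ) :
    v ∈ ends G M L₀ t := mem_ends.2 ⟨L₀, .refl t, h⟩

theorem mem_of_mem_ends {L₀ : List V} {t : ℕ} {v : V} (h : v ∈ ends G M L₀ t) : v ∈ L₀ := by
  obtain ⟨L, hL, hv⟩ := mem_ends.1 h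
  exact hL.perm.mem_iff.1 (List.mem_of_head? hv)

/-- Each rotation removes a single path edge, and one endpoint of that edge becomes the new first
vertex. Hence an edge disjoint from the set of ends was never removed. -/
theorem Reach.survives_pair {L₀ L : List V} {t : ℕ} (h : Reach G M L₀ t L) {x y : V}
    (hxy : Survives [x, y] L₀) (hx : x ∉ ends G M L₀ t) (hy : y ∉ ends G M L₀ t) :
    Survives [x, y] L := by
  induction h with
  | refl t => exact hxy
  | @step t L L' u h h' ih =>
    have ih := ih (fun h => hx (ends_subset_succ _ _ h)) (fun h => hy (ends_subset_succ _ _ h))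
    have hstep := h.step h'
    cases h' with
    | mk B a u A v hv huv hu =>
      have ha : a ∈ ends G M L₀ (t + 1) := mem_ends.2 ⟨_, hstep, rfl⟩
      refine ih.rotate fun hau => ?_
      rcases List.mem_pair.1 hau.1 with rfl | rfl
      · exact hx ha
      · exact hy ha

/-- The rotation lemma of Pósa. -/
theorem mem_ends_succ_of_adj {L₀ : List V} (hL₀ : L₀.Nodup) {t : ℕ} {a x b v : V}
    (h : Survives [a, x, b] L₀) (hx : Free M x) (hv : v ∈ ends G M L₀ t) (hvx : G.Adj v x) :
    x ∈ ends G M L₀ (t + 1) ∨ a ∈ ends G M L₀ (t + 1) ∨ b ∈ ends G M L₀ (t + 1) := by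
  by_contra! hcon
  obtain ⟨hx1, ha1, hb1⟩ := hcon
  have hx0 : x ∉ ends G M L₀ t := fun h => hx1 (ends_subset_succ _ _ h)
  have ha0 : a ∉ ends G M L₀ t := fun h => ha1 (ends_subset_succ _ _ h)
  have hb0 : b ∉ ends G M L₀ t := fun h => hb1 (ends_subset_succ _ _ h)
  have hab : a ≠ b := by
    have : ([a, x, b] : List V).Nodup := by
      rcases h with h | h
      · exact hL₀.sublist h.sublist
      · have := hL₀.sublist h.sublist
        exact List.nodup_reverse.1 this
    rintro rfl
    simp at this
  obtain ⟨L, hL, hvL⟩ := mem_ends.1 hv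
  -- Neither path edge at `x` was broken, so the neighbors of `x` on `L` are still `a` and `b`.
  -- Rotating at `x` makes its predecessor an end, and the predecessor is one of these two.
  have hax : Survives [a, x] L :=
    hL.survives_pair (Survives.trans (Or.inl ⟨[], [b], rfl⟩) h) ha0 hx0
  have hxb : Survives [x, b] L :=
    hL.survives_pair (Survives.trans (Or.inl ⟨[a], [], rfl⟩) h) hx0 hb0
  have hLn : L.Nodup := hL.perm.nodup_iff.2 hL₀
  have hxL : x ∈ L := hax.subset (by simp)
  obtain ⟨B, A, rfl⟩ := List.append_of_mem hxL
  rcases List.eq_nil_or_concat' B with rfl | ⟨B, c, rfl⟩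
  · apply hx0
    exact mem_ends.2 ⟨_, hL, rfl⟩
  · have hcx : [c, x] <:+: B ++ [c] ++ x :: A := ⟨B, A, by simp⟩
    have hc : c ∈ ends G M L₀ (t + 1) := by
      have hr : Rot G M x (B ++ [c] ++ x :: A) (c :: (B.reverse ++ x :: A)) := by
        have := Rot.mk (G := G) B c x A v (by simpa using hvL) hvx hx
        simpa using this
      exact mem_ends.2 ⟨_, hL.step hr, rfl⟩
    have hca : c ≠ a := by rintro rfl; exact ha1 hc
    have hcb : c ≠ b := by rintro rfl; exact hb1 hc
    rcases hax with h1 | h1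
    · exact hca (eq_of_infix_pred hLn hcx h1)
    · rcases hxb with h2 | h2
      · exact hab (eq_of_infix_succ hLn (by simpa using h1) h2)
      · exact hcb (eq_of_infix_pred hLn hcx (by simpa using h2))

open Classical in
/-- The vertices next to `y` on the path `L`. -/
noncomputable def pathNbrs (L : List V) (y : V) : Finset V :=
  Finset.univ.filter fun x => Survives [x, y] L

theorem card_pathNbrs_le {L : List V} (hL : L.Nodup) (y : V) : (pathNbrs L y).card ≤ 2 := by
  classical
  have h : pathNbrs L y ⊆ (Finset.univ.filter fun x => [x, y] <:+: L) ∪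
      (Finset.univ.filter fun x => [y, x] <:+: L) := by
    intro x hx
    simp only [pathNbrs, Finset.mem_filter, Finset.mem_univ, true_and] at hx
    simpa [Survives] using hx
  refine (Finset.card_le_card h).trans ((Finset.card_union_le _ _).trans ?_)
  have h1 : (Finset.univ.filter fun x => [x, y] <:+: L).card ≤ 1 :=
    Finset.card_le_one.2 fun a ha b hb =>
      eq_of_infix_pred hL (Finset.mem_filter.1 ha).2 (Finset.mem_filter.1 hb).2
  have h2 : (Finset.univ.filter fun x => [y, x] <:+: L).card ≤ 1 :=
    Finset.card_le_one.2 fun a ha b hb =>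
      eq_of_infix_succ hL (Finset.mem_filter.1 ha).2 (Finset.mem_filter.1 hb).2
  omega

/-- The closed neighborhood of `X` along the path `L`. -/
noncomputable def pathClosure (L : List V) (X : Finset V) : Finset V :=
  open Classical in X ∪ X.biUnion (pathNbrs L)

theorem card_pathClosure_le {L : List V} (hL : L.Nodup) (X : Finset V) :
    (pathClosure L X).card ≤ 3 * X.card := by
  classical
  have h1 : (X.biUnion (pathNbrs L)).card ≤ X.card * 2 :=
    Finset.card_biUnion_le_card_mul _ _ _ fun y _ => card_pathNbrs_le hL y
  have h2 := Finset.card_union_le X (X.biUnion (pathNbrs L))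
  unfold pathClosure
  convert h2.trans _ using 1
  omega

theorem mem_pathClosure {L : List V} {X : Finset V} {x : V} :
    x ∈ pathClosure L X ↔ x ∈ X ∨ ∃ y ∈ X, Survives [x, y] L := by
  simp [pathClosure, pathNbrs]

omit [Fintype V] in
theorem exists_triple_of_mem {L : List V} {x : V} (hx : x ∈ L) (h1 : L.head? ≠ some x)
    (h2 : L.getLast? ≠ some x) : ∃ a b, [a, x, b] <:+: L := by
  obtain ⟨B, A, rfl⟩ := List.append_of_mem hx
  rcases List.eq_nil_or_concat' B with rfl | ⟨B, a, rfl⟩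
  · simp at h1
  · cases A with
    | nil => simp at h2
    | cons b A => exact ⟨a, b, B, A, by simp⟩

/-- The cardinality form of the rotation lemma. -/
theorem card_le_ends_succ {L₀ : List V} (hL₀ : L₀.Nodup) {t : ℕ} {Y : Finset V}
    (hY : ∀ x ∈ Y, x ∈ L₀ ∧ Free M x ∧ ∃ v ∈ ends G M L₀ t, G.Adj v x) :
    Y.card ≤ 3 * (ends G M L₀ (t + 1)).card + 1 := by
  classical
  have hsub : Y ⊆ (Finset.univ.filter fun x => L₀.getLast? = some x) ∪
      pathClosure L₀ (ends G M L₀ (t + 1)) := by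
    intro x hx
    obtain ⟨hxL, hxf, v, hv, hvx⟩ := hY x hx
    rw [Finset.mem_union, mem_pathClosure]
    by_cases h1 : L₀.head? = some x
    · exact Or.inr (Or.inl (head_mem_ends h1 _))
    by_cases h2 : L₀.getLast? = some x
    · exact Or.inl (by simpa using h2)
    obtain ⟨a, b, hab⟩ := exists_triple_of_mem hxL h1 h2
    right
    rcases mem_ends_succ_of_adj hL₀ (Or.inl hab) hxf hv hvx with h | h | h
    · exact Or.inl h
    · exact Or.inr ⟨a, h, Survives.symm_pair (Or.inl (List.IsInfix.trans ⟨[], [b], rfl⟩ hab))⟩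
    · exact Or.inr ⟨b, h, Or.inl (List.IsInfix.trans ⟨[a], [], rfl⟩ hab)⟩
  have h1 : (Finset.univ.filter fun x => L₀.getLast? = some x).card ≤ 1 :=
    Finset.card_le_one.2 fun a ha b hb => by simp_all
  have := (Finset.card_le_card hsub).trans (Finset.card_union_le _ _)
  have := card_pathClosure_le hL₀ (ends G M L₀ (t + 1))
  omega

theorem exists_ends_stable (G M : SimpleGraph V) (L₀ : List V) :
    ∃ T, ends G M L₀ (T + 1) = ends G M L₀ T := by
  obtain ⟨T, hT⟩ := WellFoundedGT.monotone_chain_condition ⟨ends G M L₀, ends_mono L₀⟩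
  exact ⟨T, (hT (T + 1) (by omega)).symm⟩

end Ends

end Rotations

end HamCover
namespace HamCover

/-! ### Longest valid paths and their extension -/

section Extension

variable {V : Type*} {G M : SimpleGraph V}

/-- Prepend `z` if it is free, otherwise `z` together with its partner. The partner is off the path,
since a valid path containing it would contain `z` as well. -/
theorem ValidPath.exists_extension (hMG : M ≤ G)
    (hM : ∀ x y z, M.Adj x y → M.Adj x z → y = z) {L : List V} (hL : ValidPath G M L) {z : V}
    (hz : z ∉ L) (hadj : ∀ v, L.head? = some v → G.Adj z v) :
    ∃ L', ValidPath G M L' ∧ L.length < L'.length := by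
  have hchain : (z :: L).IsChain G.Adj := by
    rw [List.isChain_cons]
    exact ⟨fun y hy => hadj y hy, hL.chain⟩
  by_cases hf : Free M z
  · refine ⟨z :: L, ⟨List.nodup_cons.2 ⟨hz, hL.nodup⟩, hchain, ?_⟩, by simp⟩
    intro x y hxy hx
    rcases List.mem_cons.1 hx with rfl | hx
    · exact absurd hxy (hf y)
    · exact (hL.compat x y hxy hx).mono ⟨[z], [], by simp⟩
  · unfold Free at hf
    push Not at hf
    obtain ⟨z', hzz⟩ := hf
    have hz' : z' ∉ L := fun h => hz ((hL.compat z' z hzz.symm h).subset (by simp))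
    refine ⟨z' :: z :: L, ⟨?_, ?_, ?_⟩, by simp⟩
    · have := hzz.ne'
      simp [hz, hz', hL.nodup, this]
    · rw [List.isChain_cons_cons]
      exact ⟨hMG hzz.symm, hchain⟩
    · intro x y hxy hx
      rcases List.mem_cons.1 hx with rfl | hx
      · obtain rfl := hM _ _ _ hxy hzz.symm
        exact Or.inl ⟨[], L, rfl⟩
      rcases List.mem_cons.1 hx with rfl | hx
      · obtain rfl := hM _ _ _ hxy hzz
        exact Or.inr ⟨[], L, rfl⟩
      · exact (hL.compat x y hxy hx).mono ⟨[z', z], [], by simp⟩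

/-- Opening a closed path at another edge, which does not belong to `M`. -/
theorem ValidPath.reopen {A B : List V} {u h w : V} (hL : ValidPath G M (A ++ u :: B))
    (hh : (A ++ u :: B).head? = some h) (hw : (A ++ u :: B).getLast? = some w)
    (hhw : G.Adj w h) (ha : ∀ a, A.getLast? = some a → ¬ M.Adj a u) :
    ValidPath G M (u :: B ++ A) := by
  have hperm : (u :: B ++ A).Perm (A ++ u :: B) := List.perm_append_comm
  have hc := List.isChain_append.1 hL.chain
  refine ⟨hperm.nodup_iff.2 hL.nodup, ?_, ?_⟩
  · rw [List.isChain_append]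
    refine ⟨hc.2.1, hc.1, fun x hx y hy => ?_⟩
    have hy' : (A ++ u :: B).head? = some y := by
      cases A <;> simp_all
    have hx' : (A ++ u :: B).getLast? = some x := by
      rw [List.getLast?_append_of_ne_nil _ (by simp)]
      exact hx
    obtain rfl : h = y := by simpa [hh] using hy'
    obtain rfl : w = x := by simpa [hw] using hx'
    exact hhw
  · intro x y hxy hx
    have hs := hL.compat x y hxy (hperm.mem_iff.1 hx)
    rcases List.eq_nil_or_concat' A with rfl | ⟨A, a, rfl⟩
    · simpa using hs
    · have key : ∀ x y, M.Adj x y → [x, y] <:+: A ++ a :: u :: B →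
          [x, y] <:+: u :: B ++ (A ++ [a]) := by
        intro x y hxy hI
        have hau : ¬ M.Adj a u := ha a (by simp)
        have hnot : ¬ (a ∈ [x, y] ∧ u ∈ [x, y]) := by
          rintro ⟨h1, h2⟩
          have hne : a ≠ u := by
            rintro rfl
            have := hL.nodup
            simp [List.nodup_append] at this
          rcases List.mem_pair.1 h1 with rfl | rfl <;> rcases List.mem_pair.1 h2 with rfl | rfl
          · exact hne rfl
          · exact hau hxy
          · exact hau hxy.symm
          · exact hne rfl
        rcases infix_append_cases hI hnot with h | h
        · exact h.trans ⟨u :: B, [], by simp⟩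
        · exact h.trans ⟨[], A ++ [a], by simp⟩
      rcases hs with hs | hs
      · exact Or.inl (key x y hxy (by simpa using hs))
      · exact Or.inr (by simpa using key y x hxy.symm (by simpa using hs))

/-- Open the cycle at `u`, so that `u` becomes the first vertex, and extend to `z`. At most one of
the two cycle edges at `u` lies in `M`; if it is the one entering `u`, traverse the cycle backwards.
-/
theorem ValidPath.exists_extension_of_closed (hMG : M ≤ G)
    (hM : ∀ x y z, M.Adj x y → M.Adj x z → y = z) {C : List V} (hC : ValidPath G M C)
    {h w u z : V} (hh : C.head? = some h) (hw : C.getLast? = some w) (hhw : G.Adj h w)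
    (hu : u ∈ C) (hz : z ∉ C) (huz : G.Adj z u) :
    ∃ L', ValidPath G M L' ∧ C.length < L'.length := by
  obtain ⟨A, B, rfl⟩ := List.append_of_mem hu
  by_cases ha : ∃ a, A.getLast? = some a ∧ M.Adj a u
  · obtain ⟨a, ha, hau⟩ := ha
    have hr : (A ++ u :: B).reverse = B.reverse ++ u :: A.reverse := by simp
    have hC' : ValidPath G M (B.reverse ++ u :: A.reverse) := hr ▸ hC.reverse
    have := hC'.reopen (h := w) (w := h) (by rw [← hr, List.head?_reverse]; exact hw)
      (by rw [← hr, List.getLast?_reverse]; exact hh) hhw (by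
        intro b hb hbu
        have hab : a = b := hM _ _ _ hau.symm hbu.symm
        have haA := List.mem_of_getLast? ha
        have hbB := List.mem_of_getLast? hb
        have hn := List.nodup_append.1 hC.nodup
        exact hn.2.2 a haA b (List.mem_cons_of_mem _ (by simpa using hbB)) hab)
    obtain ⟨L', hL', hlen⟩ := this.exists_extension hMG hM (z := z)
      (by intro hmem; apply hz; simp at hmem ⊢; tauto)
      (by intro v hv; obtain rfl : u = v := by simpa using hv
          exact huz)
    exact ⟨L', hL', by simp at hlen ⊢; omega⟩
  · push Not at ha
    obtain ⟨L', hL', hlen⟩ := (hC.reopen hh hw hhw.symm ha).exists_extension hMG hM (z := z)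
      (by intro hmem; apply hz; simp at hmem ⊢; tauto)
      (by intro v hv; obtain rfl : u = v := by simpa using hv
          exact huz)
    exact ⟨L', hL', by simp at hlen ⊢; omega⟩

/-- A longest valid path. -/
def LongestPath (G M : SimpleGraph V) (L : List V) : Prop :=
  ValidPath G M L ∧ ∀ L', ValidPath G M L' → L'.length ≤ L.length

theorem exists_longestPath [Finite V] (G M : SimpleGraph V) : ∃ L, LongestPath G M L := by
  have := Fintype.ofFinite V
  classical
  let P : ℕ → Prop := fun k => ∃ L : List V, ValidPath G M L ∧ L.length = k
  have h0 : P 0 := ⟨[], ⟨by simp, by simp, by simp⟩, rfl⟩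
  have hb : ∀ k, P k → k ≤ Fintype.card V := by
    rintro k ⟨L, hL, rfl⟩
    exact hL.nodup.length_le_card
  obtain ⟨L, hL, hlen⟩ := Nat.findGreatest_spec (P := P) (Nat.zero_le (Fintype.card V)) h0
  refine ⟨L, hL, fun L' hL' => ?_⟩
  rw [hlen]
  exact Nat.le_findGreatest (hb _ ⟨L', hL', rfl⟩) ⟨L', hL', rfl⟩

theorem LongestPath.of_perm {L L' : List V} (h : LongestPath G M L) (hL' : ValidPath G M L')
    (hp : L'.Perm L) : LongestPath G M L' :=
  ⟨hL', fun L'' hL'' => (h.2 L'' hL'').trans hp.length_eq.ge⟩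

theorem LongestPath.reverse {L : List V} (h : LongestPath G M L) : LongestPath G M L.reverse :=
  h.of_perm h.1.reverse L.reverse_perm

theorem LongestPath.reach {L₀ L : List V} (h : LongestPath G M L₀) {t : ℕ}
    (hL : Reach G M L₀ t L) : LongestPath G M L :=
  h.of_perm (hL.validPath h.1) hL.perm

theorem LongestPath.mem_of_adj_head (hMG : M ≤ G)
    (hM : ∀ x y z, M.Adj x y → M.Adj x z → y = z) {L : List V} (h : LongestPath G M L) {v z : V}
    (hv : L.head? = some v) (hvz : G.Adj v z) : z ∈ L := by
  by_contra hz
  obtain ⟨L', hL', hlen⟩ := h.1.exists_extension hMG hM hz (by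
    intro v' hv'
    obtain rfl : v = v' := by simpa [hv] using hv'
    exact hvz.symm)
  exact absurd (h.2 L' hL') (by omega)

theorem LongestPath.ne_nil (hMG : M ≤ G)
    (hM : ∀ x y z, M.Adj x y → M.Adj x z → y = z) [Nonempty V] {L : List V}
    (h : LongestPath G M L) : L ≠ [] := by
  rintro rfl
  obtain ⟨L', hL', hlen⟩ := h.1.exists_extension hMG hM (z := Classical.arbitrary V) (by simp)
    (by simp)
  exact absurd (h.2 L' hL') (by omega)

theorem LongestPath.mem_of_closed (hMG : M ≤ G)
    (hM : ∀ x y z, M.Adj x y → M.Adj x z → y = z) [Fintype V]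
    (hconn : ∀ Z : Finset V, Z.Nonempty → Z ≠ Finset.univ → ∃ z ∈ Z, ∃ u ∉ Z, G.Adj z u)
    {C : List V} (hC : LongestPath G M C) {h w : V} (hh : C.head? = some h)
    (hw : C.getLast? = some w) (hhw : G.Adj h w) (x : V) : x ∈ C := by
  classical
  by_contra hx
  obtain ⟨z, hz, u, hu, hzu⟩ := hconn (Finset.univ.filter (· ∉ C)) ⟨x, by simpa using hx⟩ (by
    intro heq
    have := Finset.mem_univ h
    rw [← heq] at this
    exact (Finset.mem_filter.1 this).2 (List.mem_of_head? hh))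
  obtain ⟨L', hL', hlen⟩ := hC.1.exists_extension_of_closed hMG hM hh hw hhw (u := u) (z := z)
    (by simpa using hu) (by simpa using hz) hzu
  exact absurd (hC.2 L' hL') (by omega)

end Extension

end HamCover
namespace HamCover

/-! ### Small sets closed under rotations -/

section Closed

variable {V : Type*} [Fintype V] {G M : SimpleGraph V}

theorem mem_nbhd {A : Finset V} {v : V} : v ∈ nbhd G A ↔ v ∉ A ∧ ∃ a ∈ A, G.Adj a v := by
  simp [nbhd]

omit [Fintype V] in
/-- A set without edges to a large set is small. -/
theorem LargeExpander.card_lt {l : ℝ} (h : LargeExpander G l) {X Y : Finset V}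
    (hd : Disjoint X Y) (hX : l ≤ X.card) (hno : ∀ x ∈ X, ∀ y ∈ Y, ¬ G.Adj x y) :
    (Y.card : ℝ) < l := by
  by_contra! hY
  obtain ⟨a, ha, b, hb, hab⟩ := h X Y hd hX hY
  exact hno a ha b hb hab

/-- `X` cannot be enlarged by rotations along the path `J`. -/
def RotClosed (G M : SimpleGraph V) (J : List V) (X : Finset V) : Prop :=
  ∀ a x b v, [a, x, b] <:+: J → Free M x → v ∈ X → G.Adj v x → x ∈ X ∨ a ∈ X ∨ b ∈ X

open Classical in
/-- The vertices lying in a small set closed under rotations along `J`. -/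
noncomputable def badSet (G M : SimpleGraph V) (l : ℝ) (J : List V) : Finset V :=
  (Finset.univ.filter fun X : Finset V => RotClosed G M J X ∧ (X.card : ℝ) < l).sup id

omit [Fintype V] in
open Classical in
theorem RotClosed.union {J : List V} {X Y : Finset V} (hX : RotClosed G M J X)
    (hY : RotClosed G M J Y) : RotClosed G M J (X ∪ Y) := by
  intro a x b v hJ hx hv hvx
  simp only [Finset.mem_union] at hv ⊢
  rcases hv with hv | hv
  · have := hX a x b v hJ hx hv hvx
    tauto
  · have := hY a x b v hJ hx hv hvx
    tauto

open Classical in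
-- A gap in the sizes of closed sets. A closed set `X` has no edge to a free interior vertex of `J`
-- outside its path closure. If `l ≤ |X| < 2l`, more than `7l - 3 * 2l = l` such vertices remain,
-- contradicting the large expander property.
theorem RotClosed.card_lt {J : List V} (hJ : J.Nodup) {l : ℝ} (hG : LargeExpander G l) {m₀ : ℕ}
    (hm : (Finset.univ.filter fun x => ¬ Free M x).card ≤ m₀) (hlen : 7 * l + 2 + m₀ ≤ J.length)
    {X : Finset V} (hX : RotClosed G M J X) (hX2 : (X.card : ℝ) < 2 * l) : (X.card : ℝ) < l := by
  by_contra! hl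
  set E : Finset V := (Finset.univ.filter fun x => J.head? = some x) ∪
    (Finset.univ.filter fun x => J.getLast? = some x) with hE
  have hEc : E.card ≤ 2 := by
    refine (Finset.card_union_le _ _).trans ?_
    have h1 : (Finset.univ.filter fun x => J.head? = some x).card ≤ 1 :=
      Finset.card_le_one.2 fun a ha b hb => by simp_all
    have h2 : (Finset.univ.filter fun x => J.getLast? = some x).card ≤ 1 :=
      Finset.card_le_one.2 fun a ha b hb => by simp_all
    omega
  set Y := J.toFinset \ ((Finset.univ.filter fun x => ¬ Free M x) ∪ pathClosure J X ∪ E) with hY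
  have hYl : (Y.card : ℝ) < l := by
    refine hG.card_lt (X := X) ?_ hl ?_
    · rw [Finset.disjoint_left]
      intro x hx hxY
      rw [hY, Finset.mem_sdiff] at hxY
      apply hxY.2
      simp [mem_pathClosure, hx]
    · intro v hv x hxY hvx
      rw [hY, Finset.mem_sdiff, Finset.mem_union, Finset.mem_union, mem_pathClosure] at hxY
      obtain ⟨hxJ, hxn⟩ := hxY
      push Not at hxn
      obtain ⟨⟨hxf, hxX, hxn⟩, hxE⟩ := hxn
      simp only [Finset.mem_filter, Finset.mem_univ, true_and, not_not] at hxf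
      simp only [hE, Finset.mem_union, Finset.mem_filter, Finset.mem_univ, true_and,
        not_or] at hxE
      obtain ⟨a, b, hab⟩ := exists_triple_of_mem (by simpa using hxJ) hxE.1 hxE.2
      rcases hX a x b v hab hxf hv hvx with h | h | h
      · exact hxX h
      · exact hxn a h (Survives.symm_pair (Or.inl (List.IsInfix.trans ⟨[], [b], rfl⟩ hab)))
      · exact hxn b h (Or.inl (List.IsInfix.trans ⟨[a], [], rfl⟩ hab))
  have h1 : J.length ≤ Y.card + (m₀ + 3 * X.card + 2) := by
    rw [← List.toFinset_card_of_nodup hJ]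
    have h2 := Finset.le_card_sdiff ((Finset.univ.filter fun x => ¬ Free M x) ∪
      pathClosure J X ∪ E) J.toFinset
    have h3 := Finset.card_union_le ((Finset.univ.filter fun x => ¬ Free M x) ∪
      pathClosure J X) E
    have h4 := Finset.card_union_le (Finset.univ.filter fun x => ¬ Free M x) (pathClosure J X)
    have h5 := card_pathClosure_le hJ X
    rw [← hY] at h2
    omega
  have h2 : (J.length : ℝ) ≤ Y.card + (m₀ + 3 * X.card + 2) := by exact_mod_cast h1
  linarith

open Classical in
-- Closed sets of size below `l` are stable under union: the union is closed and smaller than `2l`,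
-- hence smaller than `l` by the gap.
theorem card_badSet_lt {J : List V} (hJ : J.Nodup) {l : ℝ} (hl : 0 < l) (hG : LargeExpander G l)
    {m₀ : ℕ} (hm : (Finset.univ.filter fun x => ¬ Free M x).card ≤ m₀)
    (hlen : 7 * l + 2 + m₀ ≤ J.length) : ((badSet G M l J).card : ℝ) < l := by
  have : RotClosed G M J (badSet G M l J) ∧ ((badSet G M l J).card : ℝ) < l := by
    unfold badSet
    refine Finset.sup_induction (p := fun X : Finset V => RotClosed G M J X ∧ (X.card : ℝ) < l)
      ⟨fun a x b v _ _ hv => by simp at hv, by simpa using hl⟩ ?_ ?_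
    · rintro X ⟨hX, hXl⟩ Y ⟨hY, hYl⟩
      refine ⟨hX.union hY, (hX.union hY).card_lt hJ hG hm hlen ?_⟩
      have : ((X ∪ Y).card : ℝ) ≤ X.card + Y.card := by exact_mod_cast Finset.card_union_le X Y
      linarith
    · intro X hX
      simpa using hX
  exact this.2

theorem subset_badSet {J : List V} {l : ℝ} {X : Finset V} (hX : RotClosed G M J X)
    (hXl : (X.card : ℝ) < l) : X ⊆ badSet G M l J := by
  classical
  have := Finset.le_sup (s := Finset.univ.filter fun X : Finset V =>
    RotClosed G M J X ∧ (X.card : ℝ) < l) (f := id) (b := X) (by simpa using ⟨hX, hXl⟩)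
  unfold badSet
  convert this using 1
  rfl

/-- Rotations with one end of a path fixed produce many ends, unless the other end is bad. -/
theorem exists_le_card_ends {L J : List V} (hL : L.Nodup) (hJ : Survives J L) {l : ℝ} {v : V}
    (hv : L.head? = some v) (hvJ : v ∉ badSet G M l J) :
    ∃ T, l ≤ ((ends G M L T).card : ℝ) := by
  obtain ⟨T, hT⟩ := exists_ends_stable G M L
  refine ⟨T, ?_⟩
  by_contra! hlt
  -- Once the ends stabilise they form a set closed under rotations along the intact block `J`. If
  -- it were smaller than `l`, its member `v` would be bad.
  refine hvJ (subset_badSet (X := ends G M L T) ?_ hlt (head_mem_ends hv T))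
  intro a x b w hI hx hw hwx
  have := mem_ends_succ_of_adj hL (Survives.trans (Or.inl hI) hJ) hx hw hwx
  rwa [hT] at this

end Closed

/-! ### Cutting a path into blocks -/

section Blocks

variable {V : Type*}

/-- The `j`-th block of length `b`. -/
def block (L : List V) (b j : ℕ) : List V := (L.drop (j * b)).take b

theorem block_infix (L : List V) (b j : ℕ) : block L b j <:+: L :=
  (List.take_prefix _ _).isInfix.trans (List.drop_suffix _ _).isInfix

theorem block_length {L : List V} {b D j : ℕ} (hD : D * b ≤ L.length) (hj : j < D) :
    (block L b j).length = b := by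
  have : (j + 1) * b ≤ D * b := Nat.mul_le_mul_right _ hj
  rw [add_mul] at this
  simp only [block, List.length_take, List.length_drop]
  omega

theorem block_disjoint {L : List V} (hL : L.Nodup) {b i j : ℕ} {x : V} (hi : x ∈ block L b i)
    (hj : x ∈ block L b j) : i = j := by
  obtain ⟨p, hp, hpx⟩ := List.mem_iff_getElem.1 hi
  obtain ⟨q, hq, hqx⟩ := List.mem_iff_getElem.1 hj
  simp only [block, List.length_take, List.length_drop, lt_min_iff] at hp hq
  simp only [block, List.getElem_take, List.getElem_drop] at hpx hqx
  have h := (hL.getElem_inj_iff).1 (hpx.trans hqx.symm)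
  have hb : 0 < b := by omega
  have h1 : (i * b + p) / b = i := by
    rw [mul_comm, Nat.mul_add_div hb, Nat.div_eq_of_lt hp.1, add_zero]
  have h2 : (j * b + q) / b = j := by
    rw [mul_comm, Nat.mul_add_div hb, Nat.div_eq_of_lt hq.1, add_zero]
  rw [← h1, ← h2, h]

/-- Two disjoint blocks lie on different sides of a suitable cut. -/
theorem exists_cut_of_infix {I J L : List V} (hI : I <:+: L) (hJ : J <:+: L) (hJ0 : J ≠ [])
    (hI0 : I ≠ []) (hL : L.Nodup) (hd : ∀ x ∈ I, x ∉ J) :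
    ∃ P Q, L = P ++ Q ∧ (I <:+: P ∧ J <:+: Q ∨ J <:+: P ∧ I <:+: Q) := by
  obtain ⟨s, t, rfl⟩ := hI
  rcases List.infix_append_iff_ne_nil.1 hJ with h | h | ⟨l₁, l₂, h₁, h₂, rfl, hs, hp⟩
  · rcases List.infix_append_iff_ne_nil.1 h with h | h | ⟨l₁, l₂, h₁, h₂, rfl, hs, hp⟩
    · exact ⟨s, I ++ t, by simp, Or.inr ⟨h, ⟨[], t, by simp⟩⟩⟩
    · obtain ⟨x, hx⟩ := List.exists_mem_of_ne_nil J hJ0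
      exact absurd hx (hd x (h.subset hx))
    · obtain ⟨x, hx⟩ := List.exists_mem_of_ne_nil l₂ h₂
      exact absurd (List.mem_append_right _ hx) (hd x (hp.subset hx))
  · exact ⟨s ++ I, t, rfl, Or.inl ⟨⟨s, [], by simp⟩, h⟩⟩
  · exfalso
    have h3 : l₁.getLast? = I.getLast? := by
      obtain ⟨r, hr⟩ := hs
      have := congrArg List.getLast? hr
      rwa [List.getLast?_append_of_ne_nil _ h₁, List.getLast?_append_of_ne_nil _ hI0] at this
    have h4 := List.getLast?_eq_some_getLast hI0
    exact hd _ (List.mem_of_getLast? h4)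
      (List.mem_append_left _ (List.mem_of_getLast? (h3.trans h4)))

theorem exists_cut {I J L : List V} (hI : Survives I L) (hJ : Survives J L) (hJ0 : J ≠ [])
    (hI0 : I ≠ []) (hL : L.Nodup) (hd : ∀ x ∈ I, x ∉ J) :
    ∃ P Q, L = P ++ Q ∧ (Survives I P ∧ Survives J Q ∨ Survives J P ∧ Survives I Q) := by
  have key : ∀ I' J', (I' = I ∨ I' = I.reverse) → (J' = J ∨ J' = J.reverse) → I' <:+: L →
      J' <:+: L →
      ∃ P Q, L = P ++ Q ∧ (Survives I P ∧ Survives J Q ∨ Survives J P ∧ Survives I Q) := by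
    intro I' J' hI' hJ' h1 h2
    have hmI : ∀ x, x ∈ I' ↔ x ∈ I := by rcases hI' with rfl | rfl <;> simp
    have hmJ : ∀ x, x ∈ J' ↔ x ∈ J := by rcases hJ' with rfl | rfl <;> simp
    have hsI : ∀ K, I' <:+: K → Survives I K := by
      rcases hI' with rfl | rfl
      · exact fun K h => Or.inl h
      · exact fun K h => Or.inr h
    have hsJ : ∀ K, J' <:+: K → Survives J K := by
      rcases hJ' with rfl | rfl
      · exact fun K h => Or.inl h
      · exact fun K h => Or.inr h
    obtain ⟨P, Q, h, h'⟩ := exists_cut_of_infix h1 h2 (by rcases hJ' with rfl | rfl <;> simpa)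
      (by rcases hI' with rfl | rfl <;> simpa) hL (by simpa [hmI, hmJ] using hd)
    exact ⟨P, Q, h, h'.imp (fun h => ⟨hsI _ h.1, hsJ _ h.2⟩) (fun h => ⟨hsJ _ h.1, hsI _ h.2⟩)⟩
  rcases hI with hI | hI <;> rcases hJ with hJ | hJ
  · exact key _ _ (Or.inl rfl) (Or.inl rfl) hI hJ
  · exact key _ _ (Or.inl rfl) (Or.inr rfl) hI hJ
  · exact key _ _ (Or.inr rfl) (Or.inl rfl) hI hJ
  · exact key _ _ (Or.inr rfl) (Or.inr rfl) hI hJ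

/-- Two of many disjoint blocks avoid a small set. -/
theorem exists_two_blocks {L : List V} (hL : L.Nodup) {b D : ℕ} (X : Finset V)
    (hX : X.card + 2 ≤ D) : ∃ i < D, ∃ j < D, i ≠ j ∧
      (∀ u ∈ X, u ∉ block L b i) ∧ (∀ u ∈ X, u ∉ block L b j) := by
  classical
  set S := (Finset.range D).filter fun j => ∃ u ∈ X, u ∈ block L b j with hS
  have hcard : S.card ≤ X.card := by
    have h : ∀ j ∈ S, ∃ u ∈ X, u ∈ block L b j := fun j hj => (Finset.mem_filter.1 hj).2
    rcases S.eq_empty_or_nonempty with h0 | ⟨j₀, hj₀⟩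
    · simp [h0]
    have : Nonempty V := ⟨(h j₀ hj₀).choose⟩
    choose! f hf hfb using h
    refine Finset.card_le_card_of_injOn f hf ?_
    intro i hi j hj hij
    have h2 := hfb j hj
    rw [← hij] at h2
    exact block_disjoint hL (hfb i hi) h2
  have h2 : 1 < (Finset.range D \ S).card := by
    have := Finset.le_card_sdiff S (Finset.range D)
    rw [Finset.card_range] at this
    omega
  obtain ⟨i, hi, j, hj, hij⟩ := Finset.one_lt_card.1 h2
  simp only [hS, Finset.mem_sdiff, Finset.mem_filter, Finset.mem_range, not_and, not_exists]
    at hi hj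
  exact ⟨i, hi.1, j, hj.1, hij, fun u hu => hi.2 hi.1 u hu, fun u hu => hj.2 hj.1 u hu⟩

end Blocks

end HamCover
namespace HamCover

/-! ### Growth of the set of ends and closing the path -/

section Growth

variable {V : Type*} [Fintype V] {G M : SimpleGraph V}

open Classical in
-- By maximality all neighbors of an end lie on the path, so the rotation lemma applies to every
-- free one.
theorem LongestPath.card_nbhd_free_le (hMG : M ≤ G)
    (hM : ∀ x y z, M.Adj x y → M.Adj x z → y = z) {L : List V} (hL : LongestPath G M L) {t : ℕ}
    {A : Finset V} (hA : A ⊆ ends G M L t) :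
    ((nbhd G A).filter (Free M)).card ≤ 3 * (ends G M L (t + 1)).card + 1 ∧
      (nbhd G A).filter (Free M) ⊆ L.toFinset := by
  have h : ∀ x ∈ (nbhd G A).filter (Free M),
      x ∈ L ∧ Free M x ∧ ∃ v ∈ ends G M L t, G.Adj v x := by
    intro x hx
    obtain ⟨hx, hxf⟩ := Finset.mem_filter.1 hx
    obtain ⟨-, v, hv, hvx⟩ := mem_nbhd.1 hx
    refine ⟨?_, hxf, v, hA hv, hvx⟩
    obtain ⟨L', hL', hvL'⟩ := mem_ends.1 (hA hv)
    exact hL'.perm.mem_iff.1 ((hL.reach hL').mem_of_adj_head hMG hM hvL' hvx)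
  exact ⟨card_le_ends_succ hL.1.nodup h, fun x hx => by simpa using (h x hx).1⟩

open Classical in
-- While there are at most `g` ends, `σ|A| ≤ 3|ends| + 1` multiplies their number by at least `(σ -
-- 1)/3`. When there are more than `g`, the step is applied to `⌊g⌋ ≥ g/2` of them, which already
-- gives `l`.
theorem LongestPath.le_card_ends (hMG : M ≤ G)
    (hM : ∀ x y z, M.Adj x y → M.Adj x z → y = z) [Nonempty V] {l g σ : ℝ}
    (hS : ∀ A : Finset V, (A.card : ℝ) ≤ g →
      A.card * σ ≤ ((nbhd G A).filter (Free M)).card)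
    (hσ : 4 ≤ σ) (hg : 1 ≤ g) (hgl : l ≤ (σ - 1) / 3 * (g / 2)) {k : ℕ}
    (hk : l ≤ ((σ - 1) / 3) ^ k) {L : List V} (hL : LongestPath G M L) :
    l ≤ (ends G M L k).card := by
  have hstep : ∀ t, ∀ A ⊆ ends G M L t, A.Nonempty → (A.card : ℝ) ≤ g →
      (σ - 1) / 3 * A.card ≤ (ends G M L (t + 1)).card := by
    intro t A hA hne hAg
    have h1 := hS A hAg
    have h2 : (((nbhd G A).filter (Free M)).card : ℝ) ≤ 3 * (ends G M L (t + 1)).card + 1 := by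
      exact_mod_cast (hL.card_nbhd_free_le hMG hM hA).1
    have h3 : (1 : ℝ) ≤ A.card := by exact_mod_cast hne.card_pos
    linarith
  have hτ : 1 ≤ (σ - 1) / 3 := by linarith
  have main : ∀ t, l ≤ (ends G M L t).card ∨ ((σ - 1) / 3) ^ t ≤ (ends G M L t).card := by
    intro t
    induction t with
    | zero =>
      right
      have h := List.head?_eq_some_head (hL.ne_nil hMG hM)
      have : 0 < (ends G M L 0).card := Finset.card_pos.2 ⟨_, head_mem_ends h 0⟩
      simpa using this
    | succ t ih =>
      have hmono : ((ends G M L t).card : ℝ) ≤ (ends G M L (t + 1)).card := by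
        exact_mod_cast Finset.card_le_card (ends_subset_succ L t)
      rcases ih with ih | ih
      · exact Or.inl (ih.trans hmono)
      have hpos : (1 : ℝ) ≤ (ends G M L t).card := (one_le_pow₀ hτ).trans ih
      rcases le_or_gt ((ends G M L t).card : ℝ) g with hc | hc
      · right
        have := hstep t _ subset_rfl (Finset.card_pos.1 (by exact_mod_cast hpos)) hc
        rw [pow_succ']
        exact (mul_le_mul_of_nonneg_left ih (by linarith)).trans this
      · left
        have hfl : ⌊g⌋₊ ≤ (ends G M L t).card := by
          have : (⌊g⌋₊ : ℝ) ≤ (ends G M L t).card :=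
            (Nat.floor_le (by linarith)).trans hc.le
          exact_mod_cast this
        obtain ⟨A, hA, hAc⟩ := Finset.exists_subset_card_eq hfl
        have h1 : 1 ≤ ⌊g⌋₊ := Nat.le_floor (by simpa using hg)
        have h2 := Nat.lt_floor_add_one g
        have h3 : g / 2 ≤ ⌊g⌋₊ := by
          have : (1 : ℝ) ≤ ⌊g⌋₊ := by exact_mod_cast h1
          linarith
        have := hstep t A hA (Finset.card_pos.1 (by omega)) (by
          rw [hAc]; exact Nat.floor_le (by linarith))
        rw [hAc] at this
        exact hgl.trans ((mul_le_mul_of_nonneg_left h3 (by linarith)).trans this)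
  rcases main k with h | h
  · exact h
  · exact hk.trans h

open Classical in
-- Take `⌈l⌉` ends. Fewer than `l` vertices lie outside this set and its neighborhood, and the free
-- part of the neighborhood lies on the path and is at most three times the next end set, plus one.
theorem LongestPath.card_bounds (hMG : M ≤ G)
    (hM : ∀ x y z, M.Adj x y → M.Adj x z → y = z) {l : ℝ} (hl : 0 < l)
    (hG : LargeExpander G l) {m₀ : ℕ}
    (hm : (Finset.univ.filter fun x => ¬ Free M x).card ≤ m₀) {L : List V}
    (hL : LongestPath G M L) {k : ℕ} (hk : l ≤ (ends G M L k).card) :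
    (Fintype.card V : ℝ) ≤ 3 * (ends G M L (k + 1)).card + 2 * l + 2 + m₀ ∧
      (Fintype.card V : ℝ) ≤ L.length + 2 * l + 2 + m₀ := by
  obtain ⟨A, hA, hAc⟩ := Finset.exists_subset_card_eq (Nat.ceil_le.2 hk)
  obtain ⟨h1, h2⟩ := hL.card_nbhd_free_le hMG hM hA
  have h3 : ((Finset.univ \ (A ∪ nbhd G A)).card : ℝ) < l := by
    refine hG.card_lt (X := A) ?_ (by rw [hAc]; exact Nat.le_ceil l) ?_
    · rw [Finset.disjoint_left]
      intro x hx
      simp [hx]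
    · intro x hx y hy hxy
      simp only [Finset.mem_sdiff, Finset.mem_univ, true_and, Finset.mem_union, mem_nbhd,
        not_or] at hy
      exact hy.2 ⟨hy.1, x, hx, hxy⟩
  have h4 : Fintype.card V ≤ (Finset.univ \ (A ∪ nbhd G A)).card + A.card +
      ((nbhd G A).filter (Free M)).card + m₀ := by
    have hsub : (Finset.univ : Finset V) ⊆ (Finset.univ \ (A ∪ nbhd G A)) ∪ A ∪
        ((nbhd G A).filter (Free M)) ∪ (Finset.univ.filter fun x => ¬ Free M x) := by
      intro x _
      simp only [Finset.mem_union, Finset.mem_sdiff, Finset.mem_filter, Finset.mem_univ,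
        true_and]
      tauto
    have h5 := Finset.card_le_card hsub
    have h6 := Finset.card_union_le ((Finset.univ \ (A ∪ nbhd G A)) ∪ A ∪
        ((nbhd G A).filter (Free M))) (Finset.univ.filter fun x => ¬ Free M x)
    have h7 := Finset.card_union_le ((Finset.univ \ (A ∪ nbhd G A)) ∪ A)
      ((nbhd G A).filter (Free M))
    have h8 := Finset.card_union_le (Finset.univ \ (A ∪ nbhd G A)) A
    rw [Finset.card_univ] at h5
    omega
  have h5 : (A.card : ℝ) ≤ l + 1 := by
    rw [hAc]
    exact (Nat.ceil_lt_add_one hl.le).le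
  have h6 : (Fintype.card V : ℝ) ≤ (Finset.univ \ (A ∪ nbhd G A)).card + A.card +
      ((nbhd G A).filter (Free M)).card + m₀ := by exact_mod_cast h4
  have h7 : (((nbhd G A).filter (Free M)).card : ℝ) ≤ 3 * (ends G M L (k + 1)).card + 1 := by
    exact_mod_cast h1
  have h8 : (((nbhd G A).filter (Free M)).card : ℝ) ≤ L.length := by
    rw [← List.toFinset_card_of_nodup hL.1.nodup]
    exact_mod_cast Finset.card_le_card h2
  constructor <;> linarith

open Classical in
/-- A longest path whose ends are adjacent. -/
theorem exists_closed_longestPath (hMG : M ≤ G)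
    (hM : ∀ x y z, M.Adj x y → M.Adj x z → y = z) {l : ℝ} (hl : 0 < l)
    (hG : LargeExpander G l) {m₀ : ℕ}
    (hm : (Finset.univ.filter fun x => ¬ Free M x).card ≤ m₀) {k b : ℕ}
    (hgrow : ∀ L, LongestPath G M L → l ≤ (ends G M L k).card)
    (hb : 7 * l + 2 + m₀ ≤ b)
    (hn : (2 * k + 4 : ℕ) * (b : ℝ) + 2 * l + 2 + m₀ ≤ Fintype.card V) :
    ∃ L h w, LongestPath G M L ∧ L.head? = some h ∧ L.getLast? = some w ∧ G.Adj h w := by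
  obtain ⟨L₀, hL₀⟩ := exists_longestPath G M
  -- Two rounds of `k + 1` rotations have at most `2k + 2` pivots; two further blocks are needed to
  -- survive.
  set D := 2 * k + 4 with hD
  have hDb : D * b ≤ L₀.length := by
    have := (hL₀.card_bounds hMG hM hl hG hm (hgrow _ hL₀)).2
    have h2 : (D : ℝ) * b ≤ L₀.length := by linarith
    exact_mod_cast h2
  have hb0 : 0 < b := by
    have : (0 : ℝ) < b := by
      have : (0 : ℝ) ≤ m₀ := by positivity
      linarith
    exact_mod_cast this
  have hblen : ∀ j < D, (block L₀ b j).length = b := fun j hj => block_length hDb hj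
  have hbne : ∀ j < D, block L₀ b j ≠ [] := by
    intro j hj h
    have := hblen j hj
    rw [h, List.length_nil] at this
    omega
  set Bad : Finset V := (Finset.range D).biUnion fun j => badSet G M l (block L₀ b j) with hBad
  have hBadc : (Bad.card : ℝ) ≤ D * l := by
    have h1 : (Bad.card : ℝ) ≤ ∑ j ∈ Finset.range D, ((badSet G M l (block L₀ b j)).card : ℝ) := by
      exact_mod_cast Finset.card_biUnion_le
    refine h1.trans ((Finset.sum_le_sum (g := fun _ => l) fun j hj => ?_).trans (by simp))
    exact (card_badSet_lt (hL₀.1.nodup.sublist (block_infix _ _ _).sublist) hl hG hm (by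
      rw [hblen j (Finset.mem_range.1 hj)]; exact hb)).le
  -- There are at least `D * b / 3 > 7 * D * l / 3` ends, but at most `D * l` bad vertices. All
  -- blocks are avoided at once because the surviving ones are not yet known.
  have hex : ∀ L, LongestPath G M L → ∃ L' v, Reach G M L (k + 1) L' ∧ L'.head? = some v ∧
      v ∉ Bad := by
    intro L hL
    have h1 := (hL.card_bounds hMG hM hl hG hm (hgrow _ hL)).1
    have h2 : Bad.card < (ends G M L (k + 1)).card := by
      have h4 : (0 : ℝ) < D := by exact_mod_cast (by omega : 0 < D)
      have h3 : (D : ℝ) * (7 * l) < D * b := by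
        refine mul_lt_mul_of_pos_left ?_ h4
        have : (0 : ℝ) ≤ m₀ := by positivity
        linarith
      have h5 : (0 : ℝ) < D * l := by positivity
      have : (Bad.card : ℝ) < (ends G M L (k + 1)).card := by linarith
      exact_mod_cast this
    obtain ⟨v, hv, hvB⟩ := Finset.exists_mem_notMem_of_card_lt_card h2
    obtain ⟨L', hL', hv'⟩ := mem_ends.1 hv
    exact ⟨L', v, hL', hv', hvB⟩
  obtain ⟨L₁, w, hr₁, hw, hwB⟩ := hex L₀ hL₀
  -- After reversal the good end `w` is last and stays fixed while the other end is moved.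
  have hL₁ := (hL₀.reach hr₁).reverse
  obtain ⟨L₂, x, hr₂, hx, hxB⟩ := hex _ hL₁
  have hL₂ := hL₁.reach hr₂
  have hw₂ : L₂.getLast? = some w := by rw [hr₂.getLast?, List.getLast?_reverse, hw]
  obtain ⟨X₁, hX₁, hs₁⟩ := hr₁.exists_pivots
  obtain ⟨X₂, hX₂, hs₂⟩ := hr₂.exists_pivots
  obtain ⟨i, hi, j, hj, hij, hiX, hjX⟩ := exists_two_blocks hL₀.1.nodup (b := b) (D := D)
    (X₁ ∪ X₂) (by have := Finset.card_union_le X₁ X₂; omega)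
  have hsurv : ∀ i, (∀ u ∈ X₁ ∪ X₂, u ∉ block L₀ b i) → Survives (block L₀ b i) L₂ := by
    intro i hiX
    refine hs₂ _ (survives_reverse_right.2 (hs₁ _ (Or.inl (block_infix _ _ _)) ?_)) ?_
    · exact fun u hu => hiX u (Finset.mem_union_left _ hu)
    · exact fun u hu => hiX u (Finset.mem_union_right _ hu)
  have hcut : ∃ P Q i j, i < D ∧ j < D ∧ L₂ = P ++ Q ∧ Survives (block L₀ b i) P ∧
      Survives (block L₀ b j) Q := by
    obtain ⟨P, Q, hPQ, h⟩ := exists_cut (hsurv i hiX) (hsurv j hjX) (hbne j hj) (hbne i hi)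
      hL₂.1.nodup (fun y hy hy' => hij (block_disjoint hL₀.1.nodup hy hy'))
    rcases h with h | h
    · exact ⟨P, Q, i, j, hi, hj, hPQ, h⟩
    · exact ⟨P, Q, j, i, hj, hi, hPQ, h⟩
  obtain ⟨P, Q, i, j, hi, hj, rfl, hiP, hjQ⟩ := hcut
  have hne : ∀ {I K : List V}, I ≠ [] → Survives I K → K ≠ [] := by
    rintro I K hI hs rfl
    exact hI (List.eq_nil_iff_forall_not_mem.2 fun y hy => by simpa using hs.subset hy)
  have hP0 := hne (hbne i hi) hiP
  have hQ0 := hne (hbne j hj) hjQ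
  have hnd := List.nodup_append.1 hL₂.1.nodup
  have hxP : P.head? = some x := by
    rwa [List.head?_append_of_ne_nil _ hP0] at hx
  have hwQ : Q.reverse.head? = some w := by
    rwa [List.getLast?_append_of_ne_nil _ hQ0, ← List.head?_reverse] at hw₂
  obtain ⟨T, hT⟩ := exists_le_card_ends hnd.1 hiP (l := l) hxP
    (fun h => hxB (Finset.mem_biUnion.2 ⟨i, Finset.mem_range.2 hi, h⟩))
  obtain ⟨T', hT'⟩ := exists_le_card_ends (List.nodup_reverse.2 hnd.2.1)
    (survives_reverse_right.2 hjQ) (l := l) hwQ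
    (fun h => hwB (Finset.mem_biUnion.2 ⟨j, Finset.mem_range.2 hj, h⟩))
  obtain ⟨a, ha, c, hc, hac⟩ := hG _ _ (by
    rw [Finset.disjoint_left]
    intro y hy hy'
    exact hnd.2.2 y (mem_of_mem_ends hy) y (by simpa using mem_of_mem_ends hy') rfl) hT hT'
  obtain ⟨P', hP', haP'⟩ := mem_ends.1 ha
  obtain ⟨Q', hQ', hcQ'⟩ := mem_ends.1 hc
  -- Replace the halves one at a time. The final path starts at `c` and ends at `a`, the two
  -- endpoints of the edge just found.
  have hv1 : ValidPath G M (Q.reverse ++ P'.reverse) := by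
    simpa using (hP'.validPath_append hL₂.1).reverse
  have hv2 : ValidPath G M (Q' ++ P'.reverse) := hQ'.validPath_append hv1
  refine ⟨Q' ++ P'.reverse, c, a, hL₂.of_perm hv2 ?_, ?_, ?_, hac.symm⟩
  · exact (List.Perm.append (hQ'.perm.trans Q.reverse_perm)
      (P'.reverse_perm.trans hP'.perm)).trans List.perm_append_comm
  · rw [List.head?_append, hcQ']
    rfl
  · rw [List.getLast?_append, List.getLast?_reverse, haP']
    rfl

end Growth

end HamCover
namespace HamCover

/-! ### From closed paths to Hamilton cycles -/

section Cycle

variable {V : Type*} [Fintype V] {G M : SimpleGraph V}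

theorem exists_isHamiltonCycle_of_list {L : List V} {h w : V} (hnd : L.Nodup)
    (hc : L.IsChain G.Adj) (hh : L.head? = some h) (hw : L.getLast? = some w) (hhw : G.Adj h w)
    (hall : ∀ x, x ∈ L) (h3 : 3 ≤ Fintype.card V) :
    ∃ H : G.Subgraph, IsHamiltonCycle H ∧ ∀ x y, Survives [x, y] L → s(x, y) ∈ H.edgeSet := by
  classical
  have hne : L ≠ [] := by rintro rfl; simp at hh
  have hlen : 3 ≤ L.length := by
    have h1 : Finset.univ ⊆ L.toFinset := fun x _ => by simpa using hall x
    have h2 := Finset.card_le_card h1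
    rw [List.toFinset_card_of_nodup hnd, Finset.card_univ] at h2
    omega
  obtain rfl : L.head hne = h := by
    rw [List.head?_eq_some_head hne] at hh
    simpa using hh
  obtain rfl : L.getLast hne = w := by
    rw [List.getLast?_eq_some_getLast hne] at hw
    simpa using hw
  set p := SimpleGraph.Walk.ofSupport L hne hc with hp
  have hsupp : p.support = L := SimpleGraph.Walk.support_ofSupport hne hc
  have hpath : p.IsPath := SimpleGraph.Walk.IsPath.mk' (by rwa [hsupp])
  -- With at least three vertices the last one is neither the first nor the second, so the closing
  -- edge is new.
  have hnot : s(L.getLast hne, L.head hne) ∉ p.edges := by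
    rw [← SimpleGraph.Walk.infix_support_iff_mem_edges, hsupp]
    obtain ⟨a, b, c, L', rfl⟩ : ∃ a b c L', L = a :: b :: c :: L' := by
      match L, hlen with
      | a :: b :: c :: L', _ => exact ⟨a, b, c, L', rfl⟩
    have hlast : (a :: b :: c :: L').getLast hne ∈ c :: L' := by
      rw [List.getLast_cons (by simp), List.getLast_cons (by simp)]
      exact List.getLast_mem _
    generalize (a :: b :: c :: L').getLast hne = z at hlast
    rintro (h1 | h1)
    · obtain ⟨s, t, hst⟩ := h1
      cases s with
      | nil =>
        simp only [List.nil_append, List.cons_append, List.head_cons] at hst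
        have h4 : a = b := (List.cons.inj (List.cons.inj hst).2).1
        simp [h4] at hnd
      | cons d s =>
        have h5 := (List.cons.inj hst).2
        have : a ∈ b :: c :: L' := by
          rw [← h5]
          simp
        exact (List.nodup_cons.1 hnd).1 this
    · have h2 : [a, b] <:+: a :: b :: c :: L' := ⟨[], c :: L', rfl⟩
      have h4 := eq_of_infix_succ hnd h1 h2
      subst h4
      exact (List.nodup_cons.1 (List.nodup_cons.1 hnd).2).1 hlast
  set q := SimpleGraph.Walk.cons hhw.symm p with hq
  refine ⟨q.toSubgraph, ⟨_, q, ?_, rfl⟩, ?_⟩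
  · refine ⟨(SimpleGraph.Walk.cons_isCycle_iff p hhw.symm).2 ⟨hpath, hnot⟩, ?_⟩
    have : q.tail.support = L := by
      rw [SimpleGraph.Walk.support_tail_of_not_nil _ (by simp [hq])]
      simp [hq, hsupp]
    intro a
    rw [this]
    exact List.count_eq_one_of_mem hnd (hall a)
  · intro x y hxy
    rw [SimpleGraph.Walk.mem_edges_toSubgraph, hq, SimpleGraph.Walk.edges_cons]
    refine List.mem_cons_of_mem _ ?_
    rw [← SimpleGraph.Walk.infix_support_iff_mem_edges, hsupp]
    simpa [Survives] using hxy

open Classical in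
/-- A sparse matching, which leaves enough neighbors of every small set uncovered, lies in a
Hamilton cycle. -/
theorem exists_isHamiltonCycle (hMG : M ≤ G)
    (hM : ∀ x y z, M.Adj x y → M.Adj x z → y = z) {l g σ : ℝ} (hl : 0 < l)
    (hG : LargeExpander G l)
    (hconn : ∀ Z : Finset V, Z.Nonempty → Z ≠ Finset.univ → ∃ z ∈ Z, ∃ u ∉ Z, G.Adj z u)
    (hS : ∀ A : Finset V, (A.card : ℝ) ≤ g →
      A.card * σ ≤ ((nbhd G A).filter (Free M)).card)
    (hσ : 4 ≤ σ) (hg : 1 ≤ g) (hgl : l ≤ (σ - 1) / 3 * (g / 2)) {k : ℕ}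
    (hk : l ≤ ((σ - 1) / 3) ^ k) {m₀ : ℕ}
    (hm : (Finset.univ.filter fun x => ¬ Free M x).card ≤ m₀) {b : ℕ}
    (hb : 7 * l + 2 + m₀ ≤ b)
    (hn : (2 * k + 4 : ℕ) * (b : ℝ) + 2 * l + 2 + m₀ ≤ Fintype.card V) :
    ∃ H : G.Subgraph, IsHamiltonCycle H ∧ ∀ x y, M.Adj x y → s(x, y) ∈ H.edgeSet := by
  have h3 : 3 ≤ Fintype.card V := by
    have h0 : (0 : ℝ) ≤ m₀ := by positivity
    have h1 : (1 : ℝ) ≤ b := by linarith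
    have h2 : (4 : ℝ) ≤ (2 * k + 4 : ℕ) := by exact_mod_cast (by omega : 4 ≤ 2 * k + 4)
    have h3 : (3 : ℝ) ≤ Fintype.card V := by nlinarith
    exact_mod_cast h3
  have : Nonempty V := Fintype.card_pos_iff.1 (by omega)
  obtain ⟨L, h, w, hL, hh, hw, hhw⟩ := exists_closed_longestPath hMG hM hl hG hm
    (fun L hL => hL.le_card_ends hMG hM hS hσ hg hgl hk) hb hn
  have hall := hL.mem_of_closed hMG hM hconn hh hw hhw
  obtain ⟨H, hH, hHe⟩ := exists_isHamiltonCycle_of_list hL.1.nodup hL.1.chain hh hw hhw hall h3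
  exact ⟨H, hH, fun x y hxy => hHe x y (hL.1.compat x y hxy (hall x))⟩

end Cycle

end HamCover
namespace HamCover

/-! ### Balanced colourings by counting -/

section Coloring

theorem card_pinned {E : Type*} [Fintype E] [DecidableEq E] {K : ℕ} (T : Finset E) (i : Fin K) :
    (Finset.univ.filter fun f : E → Fin K => ∀ e ∈ T, f e = i).card * K ^ T.card =
      K ^ Fintype.card E := by
  have h : (Finset.univ.filter fun f : E → Fin K => ∀ e ∈ T, f e = i) =
      Fintype.piFinset fun e => if e ∈ T then {i} else Finset.univ := by
    ext f
    simp only [Finset.mem_filter, Finset.mem_univ, true_and, Fintype.mem_piFinset]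
    refine forall_congr' fun e => ?_
    split_ifs with he <;> simp [he]
  rw [h, Fintype.card_piFinset]
  have h2 : ∀ e, (if e ∈ T then ({i} : Finset (Fin K)) else Finset.univ).card =
      if e ∈ T then 1 else K := by
    intro e
    split_ifs <;> simp
  simp only [h2]
  have h3 : K ^ T.card = ∏ e : E, if e ∈ T then K else 1 := by
    rw [Finset.prod_ite_mem, Finset.univ_inter, Finset.prod_const]
  rw [h3, ← Finset.prod_mul_distrib, ← Finset.card_univ, ← Finset.prod_const]
  refine Finset.prod_congr rfl fun e _ => ?_
  split_ifs <;> simp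

/-- A random colouring is balanced on all the sets of a family of large sets. -/
theorem exists_balanced_coloring {V E : Type*} [Fintype V] [Fintype E] [DecidableEq V]
    [DecidableEq E] (ε : V → E) (hε : ∀ e, (Finset.univ.filter fun x => ε x = e).card ≤ 2)
    (N : Finset V → Finset V) (𝒜 : Finset (Finset V)) (q : ℕ)
    (h𝒜 : ∀ A ∈ 𝒜, A.Nonempty ∧ q * A.card ≤ (N A).card)
    (hsmall : 256 * ((1 + (1 / 2 : ℝ) ^ q) ^ Fintype.card V - 1) < 1) :
    ∃ f : E → Fin 256, ∀ A ∈ 𝒜, ∀ i,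
      2 * ((N A).filter fun x => f (ε x) = i).card ≤ (N A).card := by
  by_contra! hcon
  -- If colour `i` takes more than half of `N A`, then, each label being shared by at most two
  -- vertices, at least `|N A|/4` labels have colour `i`. The bad colourings are thus covered by
  -- those constant on such a label set `T`.
  set S : Finset V → Fin 256 → Finset (E → Fin 256) := fun A i =>
    ((((N A).image ε).powerset.filter fun T => (N A).card ≤ 4 * T.card)).biUnion fun T =>
      Finset.univ.filter fun f : E → Fin 256 => ∀ e ∈ T, f e = i with hS
  have hcover : (Finset.univ : Finset (E → Fin 256)) ⊆
      𝒜.biUnion fun A => Finset.univ.biUnion fun i => S A i := by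
    intro f _
    obtain ⟨A, hA, i, hi⟩ := hcon f
    simp only [hS, Finset.mem_biUnion, Finset.mem_univ, true_and, Finset.mem_filter,
      Finset.mem_powerset]
    refine ⟨A, hA, i, ((N A).filter fun x => f (ε x) = i).image ε, ⟨?_, ?_⟩, ?_⟩
    · exact Finset.image_subset_image (Finset.filter_subset _ _)
    · have := Finset.card_le_mul_card_image (f := ε) ((N A).filter fun x => f (ε x) = i) 2
        (fun e _ => (Finset.card_le_card (Finset.filter_subset_filter _
          (Finset.subset_univ _))).trans (hε e))
      omega
    · intro e he
      obtain ⟨x, hx, rfl⟩ := Finset.mem_image.1 he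
      exact (Finset.mem_filter.1 hx).2
  set W : ℝ := (256 : ℝ) ^ Fintype.card E with hW
  have hWpos : 0 < W := by positivity
  have hSc : ∀ A ∈ 𝒜, ∀ i, ((S A i).card : ℝ) ≤ W * ((1 / 2 : ℝ) ^ q) ^ A.card := by
    intro A hA i
    have h1 : ((S A i).card : ℝ) ≤ ∑ T ∈ ((N A).image ε).powerset.filter
        fun T => (N A).card ≤ 4 * T.card, W * (1 / 4 : ℝ) ^ (N A).card := by
      refine le_trans (by exact_mod_cast Finset.card_biUnion_le) (?_ : ((∑ T ∈
        ((N A).image ε).powerset.filter fun T => (N A).card ≤ 4 * T.card,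
        (Finset.univ.filter fun f : E → Fin 256 => ∀ e ∈ T, f e = i).card : ℕ) : ℝ) ≤ _)
      push_cast
      refine Finset.sum_le_sum fun T hT => ?_
      have hT4 := (Finset.mem_filter.1 hT).2
      have h2 : ((Finset.univ.filter fun f : E → Fin 256 => ∀ e ∈ T, f e = i).card : ℝ) *
          256 ^ T.card = W := by
        have := card_pinned (K := 256) T i
        rw [hW]
        exact_mod_cast this
      -- This is the reason for 256 colours: as `256 = 4 ^ 4`, each `T` has probability at most `4 ^
      -- (-|N A|)`, which beats the at most `2 ^ |N A|` choices of `T`.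
      have h3 : (256 : ℝ) ^ T.card = 4 ^ (4 * T.card) := by
        rw [pow_mul]; norm_num
      have h4 : (4 : ℝ) ^ (N A).card ≤ 4 ^ (4 * T.card) :=
        pow_le_pow_right₀ (by norm_num) hT4
      rw [one_div, inv_pow, ← div_eq_mul_inv, le_div_iff₀ (by positivity), ← h2, h3]
      exact mul_le_mul_of_nonneg_left h4 (by positivity)
    have h2 : ((((N A).image ε).powerset.filter fun T => (N A).card ≤ 4 * T.card).card : ℝ) ≤
        2 ^ (N A).card := by
      have h3 := Finset.card_filter_le ((N A).image ε).powerset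
        (fun T => (N A).card ≤ 4 * T.card)
      rw [Finset.card_powerset] at h3
      have h4 : 2 ^ ((N A).image ε).card ≤ 2 ^ (N A).card :=
        Nat.pow_le_pow_right (by norm_num) Finset.card_image_le
      exact_mod_cast h3.trans h4
    rw [Finset.sum_const, nsmul_eq_mul] at h1
    refine h1.trans ?_
    calc _ ≤ (2 : ℝ) ^ (N A).card * (W * (1 / 4 : ℝ) ^ (N A).card) :=
          mul_le_mul_of_nonneg_right h2 (by positivity)
      _ = W * (1 / 2 : ℝ) ^ (N A).card := by
          rw [mul_left_comm, ← mul_pow]; norm_num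
      _ ≤ W * (1 / 2 : ℝ) ^ (q * A.card) := mul_le_mul_of_nonneg_left
          (pow_le_pow_of_le_one (by norm_num) (by norm_num) (h𝒜 A hA).2) hWpos.le
      _ = _ := by rw [pow_mul]
  have h1 : W ≤ ∑ A ∈ 𝒜, 256 * (W * ((1 / 2 : ℝ) ^ q) ^ A.card) := by
    have h2 : W = ((Finset.univ : Finset (E → Fin 256)).card : ℝ) := by
      rw [Finset.card_univ, Fintype.card_fun, Fintype.card_fin]
      push_cast
      rfl
    rw [h2]
    refine le_trans (Nat.cast_le.2 ((Finset.card_le_card hcover).trans Finset.card_biUnion_le)) ?_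
    push_cast
    rw [← h2]
    refine Finset.sum_le_sum fun A hA => ?_
    refine le_trans (by exact_mod_cast Finset.card_biUnion_le)
      (?_ : ((∑ i, (S A i).card : ℕ) : ℝ) ≤ _)
    push_cast
    refine (Finset.sum_le_sum fun i _ => hSc A hA i).trans ?_
    simp
  have h2 : ∑ A ∈ 𝒜, ((1 / 2 : ℝ) ^ q) ^ A.card ≤
      (1 + (1 / 2 : ℝ) ^ q) ^ Fintype.card V - 1 := by
    have h3 := Finset.sum_pow_mul_eq_add_pow ((1 / 2 : ℝ) ^ q) 1 (Finset.univ : Finset V)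
    simp only [one_pow, mul_one, Finset.card_univ] at h3
    -- The empty set contributes the term 1 of the binomial sum, which is the 1 subtracted in the
    -- bound.
    have h4 : insert ∅ 𝒜 ⊆ (Finset.univ : Finset V).powerset := by
      intro A _
      simp
    have h5 : ∅ ∉ 𝒜 := fun h => by simpa using (h𝒜 _ h).1
    have h6 := Finset.sum_le_sum_of_subset_of_nonneg (f := fun A : Finset V =>
      ((1 / 2 : ℝ) ^ q) ^ A.card) h4 (fun _ _ _ => by positivity)
    rw [Finset.sum_insert h5] at h6
    simp only [Finset.card_empty, pow_zero] at h6
    rw [add_comm ((1 / 2 : ℝ) ^ q)] at h3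
    linarith
  rw [← Finset.mul_sum, ← Finset.mul_sum] at h1
  have h3 : W * 1 ≤ W * (256 * ∑ A ∈ 𝒜, ((1 / 2 : ℝ) ^ q) ^ A.card) := by linarith
  have h4 := le_of_mul_le_mul_left h3 hWpos
  linarith

end Coloring

end HamCover
namespace HamCover

/-! ### Numerical estimates -/

section Numerics

/-- The number of rotations used in an `n ^ α`-expander. -/
noncomputable def rotationDepth (α : ℝ) : ℕ := ⌈1 / α⌉₊ + 1

theorem exists_large_order {α : ℝ} (hα : 0 < α) : ∃ n₀ : ℕ, ∀ n : ℕ, n₀ ≤ n →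
    Real.log n ≤ (n : ℝ) ^ α / 4 ∧ (12 : ℝ) ^ rotationDepth α ≤ (n : ℝ) ^ α ∧ 900 ≤ α * n := by
  have h1 : ∀ᶠ x : ℝ in Filter.atTop, Real.log x ≤ x ^ α / 4 := by
    have h := (isLittleO_log_rpow_atTop hα).bound (show (0 : ℝ) < 1 / 4 by norm_num)
    filter_upwards [h, Filter.eventually_ge_atTop 0] with x hx hx0
    rw [Real.norm_eq_abs, Real.norm_eq_abs, abs_of_nonneg (Real.rpow_nonneg hx0 α)] at hx
    have := le_abs_self (Real.log x)
    linarith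
  have h2 : ∀ᶠ x : ℝ in Filter.atTop, (12 : ℝ) ^ rotationDepth α ≤ x ^ α :=
    (tendsto_rpow_atTop hα).eventually_ge_atTop _
  have h3 : ∀ᶠ x : ℝ in Filter.atTop, 900 ≤ α * x := by
    filter_upwards [Filter.eventually_ge_atTop (900 / α)] with x hx
    rwa [div_le_iff₀' hα] at hx
  exact Filter.eventually_atTop.1
    (tendsto_natCast_atTop_atTop.eventually (h1.and (h2.and h3)))

/-- The power is at most `exp (n / 2 ^ q) ≤ exp (1/512) ≤ 512/511`, and `256/511 < 1`. -/
theorem one_add_half_pow_lt {n q : ℕ} (h : 512 * (n : ℝ) ≤ 2 ^ q) :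
    256 * ((1 + (1 / 2 : ℝ) ^ q) ^ n - 1) < 1 := by
  have h1 : (n : ℝ) * (1 / 2 : ℝ) ^ q ≤ 1 / 512 := by
    rw [one_div, inv_pow, ← div_eq_mul_inv, div_le_iff₀ (by positivity)]
    linarith
  have h2 : (1 + (1 / 2 : ℝ) ^ q) ^ n ≤ Real.exp (1 / 512) := by
    calc (1 + (1 / 2 : ℝ) ^ q) ^ n ≤ Real.exp ((1 / 2 : ℝ) ^ q) ^ n := by
          gcongr
          rw [add_comm]
          exact Real.add_one_le_exp _
      _ = Real.exp (n * (1 / 2 : ℝ) ^ q) := (Real.exp_nat_mul _ _).symm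
      _ ≤ _ := Real.exp_le_exp.2 h1
  have h3 : Real.exp (1 / 512) ≤ 512 / 511 := by
    have h4 := Real.one_sub_le_exp_neg (1 / 512)
    rw [Real.exp_neg] at h4
    have h5 := inv_anti₀ (by norm_num) h4
    rw [inv_inv] at h5
    exact h5.trans (by norm_num)
  linarith

theorem le_two_pow_floor {n : ℕ} {s : ℝ} (hn : 0 < n) (hs : 144 ≤ s)
    (h : Real.log n ≤ s / 4) : 512 * (n : ℝ) ≤ 2 ^ ⌊s⌋₊ := by
  have hn' : (0 : ℝ) < n := by exact_mod_cast hn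
  rw [← Real.log_le_log_iff (by positivity) (by positivity), Real.log_pow,
    Real.log_mul (by norm_num) hn'.ne']
  have h1 : Real.log 512 = 9 * Real.log 2 := by
    rw [show (512 : ℝ) = 2 ^ 9 by norm_num, Real.log_pow]
    norm_num
  have h2 := Real.log_two_gt_d9
  have h3 := Real.log_two_lt_d9
  have h4 := Nat.lt_floor_add_one s
  rw [h1]
  nlinarith

/-- Already `s ^ ⌈1/α⌉ ≥ n`; the extra factor `s` from the `+ 1` in `rotationDepth` absorbs the
constant `12 ^ rotationDepth α`. -/
theorem le_pow_rotationDepth {n : ℕ} {α s : ℝ} (hn : 0 < n) (hα : 0 < α)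
    (hs : s = (n : ℝ) ^ α) (hk : (12 : ℝ) ^ rotationDepth α ≤ s) :
    (n : ℝ) ≤ (s / 12) ^ rotationDepth α := by
  have hn1 : (1 : ℝ) ≤ n := by exact_mod_cast hn
  have hs1 : 1 ≤ s := by rw [hs]; exact Real.one_le_rpow hn1 hα.le
  rw [div_pow, le_div_iff₀ (by positivity)]
  have h1 : (n : ℝ) ≤ s ^ ⌈1 / α⌉₊ := by
    rw [hs, ← Real.rpow_natCast, ← Real.rpow_mul (by linarith)]
    have h2 : 1 ≤ α * ⌈1 / α⌉₊ := by
      have := Nat.le_ceil (1 / α)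
      rwa [div_le_iff₀' hα] at this
    calc (n : ℝ) = (n : ℝ) ^ (1 : ℝ) := (Real.rpow_one _).symm
      _ ≤ _ := Real.rpow_le_rpow_of_exponent_le hn1 h2
  have h3 : s ^ rotationDepth α = s ^ ⌈1 / α⌉₊ * s := pow_succ _ _
  rw [h3]
  exact mul_le_mul h1 hk (by positivity) (by positivity)

theorem rotationDepth_bounds {α : ℝ} (hα0 : 0 < α) (hα1 : α ≤ 1) :
    1 / α ≤ rotationDepth α ∧ ((2 * rotationDepth α + 4 : ℕ) : ℝ) ≤ 10 / α ∧
      2 ≤ rotationDepth α := by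
  have h1 := Nat.le_ceil (1 / α)
  have h2 := Nat.ceil_lt_add_one (a := 1 / α) (by positivity)
  have h3 : 1 ≤ 1 / α := by rw [le_div_iff₀ hα0]; linarith
  have h4 : 10 / α = 10 * (1 / α) := by ring
  unfold rotationDepth
  refine ⟨?_, ?_, ?_⟩
  · push_cast; linarith
  · push_cast; rw [h4]; linarith
  · have : (1 : ℝ) ≤ ⌈1 / α⌉₊ := h3.trans h1
    have : 1 ≤ ⌈1 / α⌉₊ := by exact_mod_cast this
    omega

/-- This says that the boundary `4αn/s` is at least 1. For `α < 1/2` it follows from `s² ≤ n` and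
`1/α ≤ s`. -/
theorem rpow_le_four_mul {n : ℕ} {α s : ℝ} (hn : 0 < n) (hα0 : 0 < α) (hα1 : α ≤ 1)
    (hs : s = (n : ℝ) ^ α) (hk : (12 : ℝ) ^ rotationDepth α ≤ s) : s ≤ 4 * α * n := by
  have hn1 : (1 : ℝ) ≤ n := by exact_mod_cast hn
  rcases le_or_gt (1 / 2) α with h | h
  · have h1 : s ≤ n := by
      rw [hs]
      exact (Real.rpow_le_rpow_of_exponent_le hn1 hα1).trans (Real.rpow_one _).le
    nlinarith
  · have h1 : s * s ≤ n := by
      rw [hs, ← Real.rpow_add (by linarith)]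
      exact (Real.rpow_le_rpow_of_exponent_le hn1 (by linarith : α + α ≤ 1)).trans
        (Real.rpow_one _).le
    have h2 : 1 / α ≤ s := by
      refine ((rotationDepth_bounds hα0 hα1).1.trans ?_).trans hk
      exact_mod_cast (Nat.lt_pow_self (by norm_num : 1 < 12)).le
    have hs0 : 0 < s := lt_of_lt_of_le (by positivity) h2
    rw [div_le_iff₀' hα0] at h2
    nlinarith [mul_le_mul_of_nonneg_left h1 hα0.le, mul_le_mul_of_nonneg_right h2 hs0.le]

end Numerics

/-! ### Connectivity of expanders -/

section Connected

variable {V : Type*} [Fintype V] {G : SimpleGraph V}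

/-- Expanders have an edge leaving every proper nonempty set. -/
theorem IsExpander.exists_adj_compl {s g l : ℝ} (hG : IsExpander G s g l) (hs : 0 < s)
    (hg : 1 ≤ g) (hgl : l ≤ s * (g / 2)) (Z : Finset V) (hZ : Z.Nonempty)
    (hZu : Z ≠ Finset.univ) : ∃ z ∈ Z, ∃ u ∉ Z, G.Adj z u := by
  classical
  have small : ∀ Z : Finset V, Z.Nonempty → (Z.card : ℝ) < l →
      ∃ z ∈ Z, ∃ u ∉ Z, G.Adj z u := by
    intro Z hZ hZl
    rcases le_or_gt (Z.card : ℝ) g with h | h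
    · have h1 := hG.1 Z h
      have h2 : (0 : ℝ) < Z.card := by exact_mod_cast hZ.card_pos
      have h3 : (0 : ℝ) < (nbhd G Z).card := lt_of_lt_of_le (by positivity) h1
      obtain ⟨u, hu⟩ := Finset.card_pos.1 (by exact_mod_cast h3 : 0 < (nbhd G Z).card)
      obtain ⟨hu, z, hz, hzu⟩ := mem_nbhd.1 hu
      exact ⟨z, hz, u, hu, hzu⟩
    -- A subset of size `⌊g⌋ ≥ g/2` has at least `s * g/2 ≥ l > |Z|` neighbors, so one of them is
    -- outside `Z`.
    · have hfl : ⌊g⌋₊ ≤ Z.card := by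
        have : (⌊g⌋₊ : ℝ) ≤ Z.card := (Nat.floor_le (by linarith)).trans h.le
        exact_mod_cast this
      obtain ⟨A, hA, hAc⟩ := Finset.exists_subset_card_eq hfl
      have h1 := hG.1 A (by rw [hAc]; exact Nat.floor_le (by linarith))
      have h2 : g / 2 ≤ A.card := by
        rw [hAc]
        have h3 : 1 ≤ ⌊g⌋₊ := Nat.le_floor (by simpa using hg)
        have h4 := Nat.lt_floor_add_one g
        have : (1 : ℝ) ≤ ⌊g⌋₊ := by exact_mod_cast h3
        linarith
      have h3 : (Z.card : ℝ) < (nbhd G A).card := by nlinarith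
      obtain ⟨u, hu, huZ⟩ := Finset.exists_mem_notMem_of_card_lt_card
        (by exact_mod_cast h3 : Z.card < (nbhd G A).card)
      obtain ⟨-, z, hz, hzu⟩ := mem_nbhd.1 hu
      exact ⟨z, hA hz, u, huZ, hzu⟩
  rcases lt_or_ge (Z.card : ℝ) l with h | h
  · exact small Z hZ h
  rcases lt_or_ge (Zᶜ.card : ℝ) l with h' | h'
  · have hne : Zᶜ.Nonempty := by
      rw [Finset.nonempty_iff_ne_empty]
      simpa using hZu
    obtain ⟨z, hz, u, hu, hzu⟩ := small Zᶜ hne h'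
    exact ⟨u, by simpa using hu, z, by simpa using hz, hzu.symm⟩
  · obtain ⟨a, ha, b, hb, hab⟩ := hG.2 Z Zᶜ disjoint_compl_right h h'
    exact ⟨a, ha, b, by simpa using hb, hab⟩

end Connected

end HamCover
namespace HamCover

/-! ### Splitting the matching and covering the pieces -/

section Cover

variable {V : Type*}

open Classical in
/-- The vertex matched to `x`, or `x` itself if there is none. -/
noncomputable def partner (M : SimpleGraph V) (x : V) : V :=
  if h : ∃ y, M.Adj x y then h.choose else x

theorem partner_eq {M : SimpleGraph V} (hM : ∀ x y z, M.Adj x y → M.Adj x z → y = z) {x y : V}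
    (h : M.Adj x y) : partner M x = y := by
  have hex : ∃ y, M.Adj x y := ⟨y, h⟩
  rw [partner, dif_pos hex]
  exact hM x _ _ hex.choose_spec h

theorem partner_partner {M : SimpleGraph V} (hM : ∀ x y z, M.Adj x y → M.Adj x z → y = z)
    (x : V) : partner M (partner M x) = x := by
  by_cases hex : ∃ y, M.Adj x y
  · obtain ⟨y, h⟩ := hex
    rw [partner_eq hM h, partner_eq hM h.symm]
  · have : partner M x = x := by rw [partner, dif_neg hex]
    rw [this, this]

variable [Fintype V]

/-- A label of the edge of `M` at `x`. -/
noncomputable def edgeLabel (M : SimpleGraph V) (x : V) : Fin (Fintype.card V) :=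
  min (Fintype.equivFin V x) (Fintype.equivFin V (partner M x))

theorem edgeLabel_eq {M : SimpleGraph V} (hM : ∀ x y z, M.Adj x y → M.Adj x z → y = z) {x y : V}
    (h : M.Adj x y) : edgeLabel M x = edgeLabel M y := by
  rw [edgeLabel, edgeLabel, partner_eq hM h, partner_eq hM h.symm, min_comm]

open Classical in
theorem card_edgeLabel_fiber_le {M : SimpleGraph V}
    (hM : ∀ x y z, M.Adj x y → M.Adj x z → y = z) (i : Fin (Fintype.card V)) :
    (Finset.univ.filter fun x => edgeLabel M x = i).card ≤ 2 := by
  have hsub : (Finset.univ.filter fun x => edgeLabel M x = i) ⊆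
      {(Fintype.equivFin V).symm i, partner M ((Fintype.equivFin V).symm i)} := by
    intro x hx
    have hx : edgeLabel M x = i := by simpa using hx
    rw [Finset.mem_insert, Finset.mem_singleton]
    rcases min_choice (Fintype.equivFin V x) (Fintype.equivFin V (partner M x)) with h | h
    · left
      rw [← hx, edgeLabel, h, Equiv.symm_apply_apply]
    · right
      rw [← hx, edgeLabel, h, Equiv.symm_apply_apply, partner_partner hM]
  exact (Finset.card_le_card hsub).trans Finset.card_le_two

open Classical in
theorem card_edgeLabel_block_le {M : SimpleGraph V}
    (hM : ∀ x y z, M.Adj x y → M.Adj x z → y = z) {q : ℕ} (hq : 0 < q) (j : ℕ) :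
    (Finset.univ.filter fun x => (edgeLabel M x : ℕ) / q = j).card ≤ 2 * q := by
  set S := Finset.univ.filter fun x => (edgeLabel M x : ℕ) / q = j with hS
  refine (Finset.card_le_mul_card_image (f := edgeLabel M) S 2 fun e _ =>
    (Finset.card_le_card (Finset.filter_subset_filter _ (Finset.subset_univ _))).trans
      (card_edgeLabel_fiber_le hM e)).trans ?_
  refine Nat.mul_le_mul_left 2 ?_
  conv_rhs => rw [← Finset.card_range q]
  -- Labels with the same quotient by `q` are determined by their remainders.
  refine Finset.card_le_card_of_injOn (fun e => (e : ℕ) % q) ?_ ?_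
  · intro e _
    simpa using Nat.mod_lt _ hq
  · intro a ha b hb hab
    have hdiv : ∀ a ∈ S.image (edgeLabel M), (a : ℕ) / q = j := by
      intro a ha
      obtain ⟨x, hx, rfl⟩ := Finset.mem_image.1 ha
      exact (Finset.mem_filter.1 hx).2
    have h1 := hdiv a ha
    have h2 := hdiv b hb
    have hab : (a : ℕ) % q = (b : ℕ) % q := hab
    have h3 := Nat.div_add_mod (a : ℕ) q
    have h4 := Nat.div_add_mod (b : ℕ) q
    rw [h1] at h3
    rw [h2] at h4
    exact Fin.ext (by omega)

/-- The edges of `M` satisfying a condition on their labels. -/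
def subMatching (M : SimpleGraph V) (P : Fin (Fintype.card V) → Prop) : SimpleGraph V where
  Adj x y := M.Adj x y ∧ P (edgeLabel M x) ∧ P (edgeLabel M y)
  symm := ⟨fun _ _ h => ⟨h.1.symm, h.2.2, h.2.1⟩⟩
  loopless := ⟨fun _ h => h.1.ne rfl⟩

/-- Every matching of a suitable expander is covered by few Hamilton cycles. -/
theorem IsExpander.exists_cover {G M : SimpleGraph V} {s g l : ℝ} (hG : IsExpander G s g l)
    (hMG : M ≤ G) (hM : ∀ x y z, M.Adj x y → M.Adj x z → y = z) (hl : 0 < l) (hs : 8 ≤ s)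
    (hg : 1 ≤ g) (hgl : l ≤ (s / 2 - 1) / 3 * (g / 2)) {k : ℕ}
    (hk : l ≤ ((s / 2 - 1) / 3) ^ k)
    (hsmall : 256 * ((1 + (1 / 2 : ℝ) ^ ⌊s⌋₊) ^ Fintype.card V - 1) < 1) {q : ℕ} (hq : 0 < q)
    {b : ℕ} (hb : 7 * l + 2 + (2 * q : ℕ) ≤ b)
    (hn : (2 * k + 4 : ℕ) * (b : ℝ) + 2 * l + 2 + (2 * q : ℕ) ≤ Fintype.card V) :
    ∃ C : Finset G.Subgraph, C.card ≤ 256 * (Fintype.card V / q + 1) ∧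
      (∀ H ∈ C, IsHamiltonCycle H) ∧ ∀ x y, M.Adj x y → ∃ H ∈ C, s(x, y) ∈ H.edgeSet := by
  classical
  obtain ⟨f, hf⟩ := exists_balanced_coloring (edgeLabel M)
    (fun e => (card_edgeLabel_fiber_le hM e)) (nbhd G)
    (Finset.univ.filter fun A => A.Nonempty ∧ (A.card : ℝ) ≤ g) ⌊s⌋₊ (by
      intro A hA
      obtain ⟨hne, hAg⟩ := (Finset.mem_filter.1 hA).2
      refine ⟨hne, ?_⟩
      have h1 := hG.1 A hAg
      have h2 : (⌊s⌋₊ : ℝ) ≤ s := Nat.floor_le (by linarith)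
      have h3 : (⌊s⌋₊ : ℝ) * A.card ≤ (nbhd G A).card := by
        refine le_trans ?_ h1
        rw [mul_comm]
        exact mul_le_mul_of_nonneg_left h2 (by positivity)
      exact_mod_cast h3) hsmall
  have hcyc : ∀ c : Fin 256 × ℕ, ∃ H : G.Subgraph, IsHamiltonCycle H ∧ ∀ x y,
      (subMatching M fun e => f e = c.1 ∧ (e : ℕ) / q = c.2).Adj x y → s(x, y) ∈ H.edgeSet := by
    rintro ⟨i, j⟩
    set M' := subMatching M fun e => f e = i ∧ (e : ℕ) / q = j with hM'
    have hnf : ∀ x, ¬ Free M' x → f (edgeLabel M x) = i ∧ (edgeLabel M x : ℕ) / q = j := by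
      intro x hx
      unfold Free at hx
      push Not at hx
      obtain ⟨y, hy⟩ := hx
      exact hy.2.1
    refine exists_isHamiltonCycle (M := M') (fun x y h => hMG h.1)
      (fun x y z h h' => hM x y z h.1 h'.1) hl hG.2
      (hG.exists_adj_compl (by linarith) hg (hgl.trans ?_)) (σ := s / 2) ?_ (by linarith) hg hgl
      hk (m₀ := 2 * q) ?_ hb hn
    · exact mul_le_mul_of_nonneg_right (by linarith) (by linarith)
    · intro A hAg
      rcases A.eq_empty_or_nonempty with rfl | hne
      · simp
      have h1 := hG.1 A hAg
      have h2 := hf A (by simpa using ⟨hne, hAg⟩) i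
      have h3 := Finset.card_filter_add_card_filter_not (s := nbhd G A) (Free M')
      have h4 : ((nbhd G A).filter fun x => ¬ Free M' x).card ≤
          ((nbhd G A).filter fun x => f (edgeLabel M x) = i).card := by
        refine Finset.card_le_card fun x hx => ?_
        rw [Finset.mem_filter] at hx ⊢
        exact ⟨hx.1, (hnf x hx.2).1⟩
      -- A covered vertex has colour `i`, and at most half of the neighborhood does; so small sets
      -- expand by `s/2` into free vertices.
      have h5 : (nbhd G A).card ≤ 2 * ((nbhd G A).filter (Free M')).card := by omega
      have h6 : ((nbhd G A).card : ℝ) ≤ 2 * ((nbhd G A).filter (Free M')).card := by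
        exact_mod_cast h5
      linarith
    · refine le_trans (Finset.card_le_card fun x hx => ?_) (card_edgeLabel_block_le hM hq j)
      rw [Finset.mem_filter] at hx ⊢
      exact ⟨hx.1, (hnf x hx.2).2⟩
  choose H hH hHe using hcyc
  obtain ⟨S, hS⟩ : ∃ S : Finset (Fin 256), S = Finset.univ := ⟨_, rfl⟩
  refine ⟨(S ×ˢ Finset.range (Fintype.card V / q + 1)).image H, ?_, ?_, ?_⟩
  · refine Finset.card_image_le.trans ?_
    rw [Finset.card_product, Finset.card_range, hS, Finset.card_univ, Fintype.card_fin]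
  · intro K hK
    obtain ⟨c, -, rfl⟩ := Finset.mem_image.1 hK
    exact hH c
  · intro x y hxy
    refine ⟨H (f (edgeLabel M x), (edgeLabel M x : ℕ) / q), ?_, hHe _ x y ?_⟩
    · refine Finset.mem_image_of_mem _ (Finset.mem_product.2 ⟨hS ▸ Finset.mem_univ _, ?_⟩)
      rw [Finset.mem_range]
      exact Nat.lt_succ_of_le (Nat.div_le_div_right (edgeLabel M x).2.le)
    · exact ⟨hxy, ⟨rfl, rfl⟩, by rw [edgeLabel_eq hM hxy]; exact ⟨rfl, rfl⟩⟩

end Cover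

end HamCover

/-! ### The choice of parameters -/

theorem mainTheorem3 (α : ℝ) (hα0 : 0 < α) (hα1 : α ≤ 1) :
    ∃ n₀ : ℕ, ∀ n : ℕ, n₀ ≤ n →
      ∀ (V : Type*) [Fintype V], Fintype.card V = n →
        ∀ G : SimpleGraph V, HamCover.IsSExpander G ((n : ℝ) ^ α) →
          ∀ M : G.Subgraph, M.IsMatching →
            ∃ C : Finset G.Subgraph,
              (C.card : ℝ) ≤ 14000 / α ^ 4 ∧
              (∀ H ∈ C, HamCover.IsHamiltonCycle H) ∧
              M.edgeSet ⊆ ⋃ H ∈ C, H.edgeSet := by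
  obtain ⟨n₀, hn₀⟩ := HamCover.exists_large_order hα0
  refine ⟨n₀, fun n hn V _ hV G hG M hM => ?_⟩
  obtain ⟨hlog, hk, hαn⟩ := hn₀ n hn
  have hn900 : (900 : ℝ) ≤ n := by
    have : (0 : ℝ) ≤ n := by positivity
    nlinarith
  have hnpos : 0 < n := by
    have : (0 : ℝ) < n := by linarith
    exact_mod_cast this
  have hlogpos : 0 < Real.log n := Real.log_pos (by linarith)
  obtain ⟨hk1, hk2, hk3⟩ := HamCover.rotationDepth_bounds hα0 hα1
  set s : ℝ := (n : ℝ) ^ α with hs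
  have hsk := HamCover.le_pow_rotationDepth hnpos hα0 hs hk
  have hs4 := HamCover.rpow_le_four_mul hnpos hα0 hα1 hs hk
  have hs144 : 144 ≤ s := by
    refine le_trans ?_ hk
    calc (144 : ℝ) = 12 ^ 2 := by norm_num
      _ ≤ 12 ^ HamCover.rotationDepth α := pow_le_pow_right₀ (by norm_num) hk3
  have hspos : 0 < s := by linarith
  have hlogs : Real.log s = α * Real.log n := by
    rw [hs, Real.log_rpow (by linarith)]
  have hG' : HamCover.IsExpander G s (4 * α * n / s) (α * n / 3000) := by
    have h := hG
    unfold HamCover.IsSExpander at h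
    rw [hV, hlogs] at h
    convert h using 1
    · field_simp
    · field_simp
  have hτ : s / 12 ≤ (s / 2 - 1) / 3 := by linarith
  have hαle : α * n ≤ n := by nlinarith
  -- Blocks must exceed `7l + 2 + 2q`, where `2q ≤ αn/25`, so `b ≈ αn/15` suffices. The at most
  -- `10/α` blocks then use at most `2n/3` vertices.
  set q := ⌊α * n / 50⌋₊ with hq
  set b := ⌊α * n / 15⌋₊ with hb
  have hq1 : (q : ℝ) ≤ α * n / 50 := Nat.floor_le (by positivity)
  have hq2 : α * n / 50 < q + 1 := Nat.lt_floor_add_one _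
  have hb1 : (b : ℝ) ≤ α * n / 15 := Nat.floor_le (by positivity)
  have hb2 : α * n / 15 < b + 1 := Nat.lt_floor_add_one _
  have hq0 : (0 : ℝ) < q := by linarith
  obtain ⟨C, hC, hCH, hCM⟩ := hG'.exists_cover (M := M.spanningCoe)
    (SimpleGraph.Subgraph.spanningCoe_le M)
    (fun x y z hxy hxz => (hM (M.edge_vert hxy)).unique hxy hxz)
    (by positivity) (by linarith)
    (by rw [le_div_iff₀ hspos]; linarith)
    (by
      calc α * n / 3000 ≤ s / 12 * (4 * α * n / s / 2) := by
            field_simp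
            norm_num
        _ ≤ _ := mul_le_mul_of_nonneg_right hτ (by positivity))
    (k := HamCover.rotationDepth α)
    (by
      refine le_trans (by linarith) (hsk.trans ?_)
      exact pow_le_pow_left₀ (by positivity) hτ _)
    (HamCover.one_add_half_pow_lt
      (by rw [hV]; exact HamCover.le_two_pow_floor hnpos hs144 hlog))
    (q := q) (by exact_mod_cast hq0) (b := b)
    (by push_cast; linarith)
    (by
      have h1 : ((2 * HamCover.rotationDepth α + 4 : ℕ) : ℝ) * b ≤ 10 / α * (α * n / 15) :=
        mul_le_mul hk2 hb1 (by positivity) (by positivity)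
      have h2 : 10 / α * (α * n / 15) = 2 / 3 * n := by field_simp; norm_num
      rw [hV]
      push_cast at h1 ⊢
      linarith)
  refine ⟨C, ?_, hCH, ?_⟩
  · have h1 : (C.card : ℝ) ≤ 256 * ((n / q : ℕ) + 1) := by
      rw [hV] at hC
      exact_mod_cast hC
    -- Rounding `q` down costs the step from 50 to 53, affordable because `αn ≥ 900`. The total is
    -- at most `256 * 54 / α = 13824 / α`, stronger in `α` than required.
    have h2 : ((n / q : ℕ) : ℝ) ≤ 53 / α := by
      refine Nat.cast_div_le.trans ?_
      rw [div_le_div_iff₀ hq0 hα0]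
      linarith
    have h3 : 1 ≤ 1 / α := by rw [le_div_iff₀ hα0]; linarith
    have h4 : 1 / α ≤ 1 / α ^ 4 := by
      refine one_div_le_one_div_of_le (by positivity) ?_
      exact (pow_le_pow_of_le_one hα0.le hα1 (by norm_num : 1 ≤ 4)).trans (pow_one α).le
    rw [show (53 : ℝ) / α = 53 * (1 / α) by ring] at h2
    rw [show (14000 : ℝ) / α ^ 4 = 14000 * (1 / α ^ 4) by ring]
    linarith
  · intro e
    induction e using Sym2.ind with
    | _ x y =>
      intro he
      obtain ⟨H, hH, hxy⟩ := hCM x y (by simpa using he)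
      exact Set.mem_iUnion₂.2 ⟨H, hH, hxy⟩
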